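/- For real constants $C_{ij}{}^k=C_{ji}{}^k$ ($i,j,k\in\{1,2\}$), let $\nabla=\nabla^C$ be the torsion free connection on $M=\mathbb{R}^+\times\mathbb{R}$, with coordinates $(x^1,x^2)$, $x^1>0$, whose Christoffel symbols are $\Gamma_{ij}{}^k=(x^1)^{-1}C_{ij}{}^k$; the pair $\mathcal{M}=(M,\nabla)$ is called a Type $\mathcal{B}$ surface. It is also of Type $\mathcal{A}$ if $M$ has an atlas of smooth coordinate systems in each of which the Christoffel symbols of $\nabla$ are constant. Two Type $\mathcal{B}$ surfaces are linearly equivalent if their connections are intertwined by a map $(x^1,x^2)\mapsto(x^1,ax^1+bx^2)$ with $a,b\in\mathbb{R}$, $b\ne0$. Let $R(X,Y)=\nabla_X\nabla_Y-\nabla_Y\nabla_X-\nabla_{[X,Y]}$, let $\rho(X,Y)=\operatorname{Tr}\{Z\mapsto R(Z,X)Y\}$ be the Ricci tensor, and let $\rho_s(X,Y)=\frac12\{\rho(X,Y)+\rho(Y,X)\}$. For $\mu\in\mathbb{R}$ let $$E(\mu,\nabla)=\{f\in C^\infty(M;\mathbb{R}):\ \partial_{x^i}\partial_{x^j}f-\Gamma_{ij}{}^k\partial_{x^k}f=\mu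 f(\rho_s)_{ij}\ \text{ for all } i,j\}.$$ **Theorem 1.17.** Let $\mathcal{M}$ be a Type $\mathcal{B}$ surface which is not of Type $\mathcal{A}$ and for which $\rho_s$ does not vanish identically. Let $\mu\in\mathbb{R}\setminus\{0,-1\}$. Then $\dim E(\mu,\nabla)\ge1$ if and only if, for some choice of sign $\varepsilon\in\{1,-1\}$, $\mathcal{M}$ is linearly equivalent to a Type $\mathcal{B}$ surface with $$C_{12}{}^1=0,\qquad C_{22}{}^1=\varepsilon,\qquad C_{22}{}^2=2\varepsilon C_{11}{}^2,\qquad C_{11}{}^1-C_{12}{}^2-1\ne0,$$ $$\mu=\frac{-(C_{11}{}^1)^2+2C_{11}{}^1C_{12}{}^2+2\varepsilon(C_{11}{}^2)^2-(C_{12}{}^2)^2+2C_{12}{}^2+1}{(C_{11}{}^1-C_{12}{}^2-1)^2}.$$ Furthermore, $\dim E(\mu,\nabla)=2$ if and only if, for some choice of sign $\varepsilon\in\{1,-1\}$, $\mathcal{M}$ is linearly equivalent to a Type $\mathcal{B}$ surface satisfying one of the following: 1. $C_{11}{}^1=-1+C_{12}{}^2$, $C_{11}{}^2=0$, $C_{12}{}^1=0$,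 $C_{22}{}^1=\varepsilon$, $C_{22}{}^2=0$, and $\mu=\frac12C_{12}{}^2\ne0$; 2. $C_{11}{}^1=-\frac12\left(5+16\varepsilon(C_{11}{}^2)^2\right)$, $C_{12}{}^1=0$, $C_{12}{}^2=-\frac12\left(3+8\varepsilon(C_{11}{}^2)^2\right)$, $C_{22}{}^1=\varepsilon$, $C_{22}{}^2=2\varepsilon C_{11}{}^2$, $C_{11}{}^2\ne0$, $4+8\varepsilon(C_{11}{}^2)^2\ne0$, and $\mu=-\dfrac{3+8\varepsilon(C_{11}{}^2)^2}{4+8\varepsilon(C_{11}{}^2)^2}$. -/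

import Mathlib

open scoped ContDiff

noncomputable section

namespace HomogeneousSurface

/-- The coordinate plane `ℝ²`. The paper's coordinate `x¹` is `x 0` and `x²` is `x 1`; all tensor
indices `1, 2` become `0, 1`. -/
abbrev Plane : Type := Fin 2 → ℝ

/-- The underlying manifold `ℝ⁺ × ℝ` of a Type `B` surface. -/
def halfPlane : Set Plane := {x | 0 < x 0}

/-- The partial derivative `∂ᵢ f` at `x`. -/
def pd (i : Fin 2) (f : Plane → ℝ) (x : Plane) : ℝ := fderiv ℝ f x (Pi.single i 1)

/-- The Christoffel symbols of a connection in the coordinates of the plane: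
`Γ x i j k` is `Γ_{ij}^k` at the point `x`, that is `∇_{∂ᵢ} ∂ⱼ = Γ_{ij}^k ∂ₖ`. -/
abbrev Christoffel : Type := Plane → Fin 2 → Fin 2 → Fin 2 → ℝ

/-- Real constants `C_{ij}^k` that are symmetric in `i, j` (torsion-freeness). -/
structure Coeff where
  /-- `c i j k` is `C_{ij}^k`. -/
  c : Fin 2 → Fin 2 → Fin 2 → ℝ
  symm : ∀ i j k, c i j k = c j i k

/-- The connection with constant Christoffel symbols `Γ_{ij}^k = C_{ij}^k`. -/
def typeA (C : Coeff) : Christoffel := fun _ i j k => C.c i j k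

/-- The connection `∇^C` with Christoffel symbols `Γ_{ij}^k = (x¹)⁻¹ C_{ij}^k`; it is used on
`halfPlane` only. -/
def typeB (C : Coeff) : Christoffel := fun x i j k => (x 0)⁻¹ * C.c i j k

/-- The components `R_{ijk}^l` of the curvature, `R(∂ᵢ, ∂ⱼ) ∂ₖ = R_{ijk}^l ∂ₗ`, where
`R(X, Y) = ∇_X ∇_Y - ∇_Y ∇_X - ∇_{[X, Y]}`. -/
def curvature (Γ : Christoffel) (x : Plane) (i j k l : Fin 2) : ℝ :=
  pd i (fun y => Γ y j k l) x - pd j (fun y => Γ y i k l) x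
    + ∑ n, (Γ x i n l * Γ x j k n - Γ x j n l * Γ x i k n)

/-- The Ricci tensor `ρ(X, Y) = Tr {Z ↦ R(Z, X) Y}`. -/
def ricci (Γ : Christoffel) (x : Plane) (j k : Fin 2) : ℝ := ∑ i, curvature Γ x i j k i

/-- The symmetric Ricci tensor `ρ_s(X, Y) = (ρ(X, Y) + ρ(Y, X)) / 2`. -/
def symRicci (Γ : Christoffel) (x : Plane) (i j : Fin 2) : ℝ :=
  (ricci Γ x i j + ricci Γ x j i) / 2

/-- The Hessian `∂ᵢ ∂ⱼ f - Γ_{ij}^k ∂ₖ f`. -/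
def hessian (Γ : Christoffel) (f : Plane → ℝ) (x : Plane) (i j : Fin 2) : ℝ :=
  pd i (pd j f) x - ∑ k, Γ x i j k * pd k f x

theorem isOpen_halfPlane : IsOpen halfPlane :=
  isOpen_lt continuous_const (continuous_apply 0)

theorem contDiffOn_pd {f : Plane → ℝ} (hf : ContDiffOn ℝ ∞ f halfPlane) (i : Fin 2) :
    ContDiffOn ℝ ∞ (pd i f) halfPlane :=
  (hf.fderiv_of_isOpen isOpen_halfPlane (by simp)).clm_apply contDiffOn_const

theorem differentiableAt_of_contDiffOn {f : Plane → ℝ} (hf : ContDiffOn ℝ ∞ f halfPlane)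
    {x : Plane} (hx : x ∈ halfPlane) : DifferentiableAt ℝ f x :=
  (hf.contDiffAt (isOpen_halfPlane.mem_nhds hx)).differentiableAt (by simp)

theorem pd_add {f g : Plane → ℝ} (hf : ContDiffOn ℝ ∞ f halfPlane)
    (hg : ContDiffOn ℝ ∞ g halfPlane) (i : Fin 2) {x : Plane} (hx : x ∈ halfPlane) :
    pd i (f + g) x = pd i f x + pd i g x := by
  simp [pd, fderiv_add (differentiableAt_of_contDiffOn hf hx)
    (differentiableAt_of_contDiffOn hg hx)]

theorem pd_smul (a : ℝ) (f : Plane → ℝ) (i : Fin 2) (x : Plane) :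
    pd i (a • f) x = a * pd i f x := by
  simp [pd, fderiv_const_smul_field]

theorem pd_pd_add {f g : Plane → ℝ} (hf : ContDiffOn ℝ ∞ f halfPlane)
    (hg : ContDiffOn ℝ ∞ g halfPlane) (i j : Fin 2) {x : Plane} (hx : x ∈ halfPlane) :
    pd i (pd j (f + g)) x = pd i (pd j f) x + pd i (pd j g) x := by
  rw [← pd_add (contDiffOn_pd hf j) (contDiffOn_pd hg j) i hx]
  have h : pd j (f + g) =ᶠ[nhds x] pd j f + pd j g := by
    filter_upwards [isOpen_halfPlane.mem_nhds hx] with y hy using pd_add hf hg j hy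
  simp only [pd]
  exact congrArg (fun L : Plane →L[ℝ] ℝ => L (Pi.single i 1)) h.fderiv_eq

/-- The eigenspace `E(μ, ∇)` of the affine quasi-Einstein equation on `halfPlane`: the real vector
space of all `f ∈ C^∞(ℝ⁺ × ℝ)` with `Hess f = μ f ρ_s`. A function on `halfPlane` is represented by
its extension by `0` to the plane, so that each function on `halfPlane` has exactly one
representative. -/
def eigenspace (μ : ℝ) (Γ : Christoffel) : Submodule ℝ (Plane → ℝ) where
  carrier := {f | ContDiffOn ℝ ∞ f halfPlane ∧ (∀ x, x ∉ halfPlane → f x = 0) ∧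
    ∀ x ∈ halfPlane, ∀ i j, hessian Γ f x i j = μ * f x * symRicci Γ x i j}
  zero_mem' := by
    refine ⟨contDiffOn_const, fun _ _ => rfl, fun x _ i j => ?_⟩
    have h : ∀ i, pd i (0 : Plane → ℝ) = 0 := fun i => by
      funext y
      simp [pd]
    simp [hessian, h]
  add_mem' := by
    rintro f g ⟨hf, hf0, hfe⟩ ⟨hg, hg0, hge⟩
    refine ⟨hf.add hg, fun x hx => by simp [hf0 x hx, hg0 x hx], fun x hx i j => ?_⟩
    have h1 := hfe x hx i j
    have h2 := hge x hx i j
    simp only [hessian, pd_pd_add hf hg i j hx, pd_add hf hg _ hx, Fin.sum_univ_two,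
      Pi.add_apply] at h1 h2 ⊢
    linear_combination h1 + h2
  smul_mem' := by
    rintro a f ⟨hf, hf0, hfe⟩
    refine ⟨contDiffOn_const.smul hf, fun x hx => by simp [hf0 x hx], fun x hx i j => ?_⟩
    have h1 := hfe x hx i j
    have h2 : ∀ j, pd j (a • f) = a • pd j f := fun j => by
      funext y
      simp [pd_smul]
    simp only [hessian, h2, pd_smul, Fin.sum_univ_two, Pi.smul_apply, smul_eq_mul] at h1 ⊢
    linear_combination a * h1

/-- On the open set `U`, the smooth map `φ` intertwines the connections `Γ` and `Γ'`, that is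
`∇'_{φ_* ∂ᵢ} (φ_* ∂ⱼ) = φ_* (∇_{∂ᵢ} ∂ⱼ)`; this is the transformation law of Christoffel symbols.
If `φ` is a coordinate system on `U`, then `Γ'` are the Christoffel symbols of `Γ` in it. -/
def Intertwines (U : Set Plane) (φ : Plane → Plane) (Γ Γ' : Christoffel) : Prop :=
  ∀ x ∈ U, ∀ i j c,
    pd i (pd j (fun y => φ y c)) x
        + ∑ a, ∑ b, Γ' (φ x) a b c * pd i (fun y => φ y a) x * pd j (fun y => φ y b) x
      = ∑ k, Γ x i j k * pd k (fun y => φ y c) x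

/-- The surface `(ℝ⁺ × ℝ, Γ)` is (also) of Type `A`: it has an atlas of smooth coordinate systems
in each of which the Christoffel symbols are constant. (Non-flatness, which is part of the
convention for the Types, is not repeated here.) -/
def IsTypeA (Γ : Christoffel) : Prop :=
  ∀ p ∈ halfPlane, ∃ φ : OpenPartialHomeomorph Plane Plane,
    p ∈ φ.source ∧ φ.source ⊆ halfPlane ∧
    ContDiffOn ℝ ∞ φ φ.source ∧ ContDiffOn ℝ ∞ φ.symm φ.target ∧
    ∃ A : Coeff, Intertwines φ.source φ Γ (typeA A)

/-- The Type `B` surfaces given by `C` and `D` are linearly equivalent: they are intertwined by a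
map `(x¹, x²) ↦ (x¹, a x¹ + b x²)` of `ℝ⁺ × ℝ` with `b ≠ 0`. -/
def LinearlyEquivalent (C D : Coeff) : Prop :=
  ∃ a b : ℝ, b ≠ 0 ∧
    Intertwines halfPlane (fun x => ![x 0, a * x 0 + b * x 1]) (typeB C) (typeB D)

end HomogeneousSurface

end

/-!
A function `f` solves the quasi-Einstein equation if and only if its weighted jet
`F = (f, x¹ ∂₁ f, x¹ ∂₂ f)` satisfies `x¹ ∂₁ F = P F` and `x¹ ∂₂ F = Q F` with constant `3 × 3`
matrices `P` and `Q` (`jetOp`): the weights absorb the powers of `x¹` in the Christoffel symbols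
and in the Ricci tensor. Since second derivatives commute, `[Q, P] = Q` on jets. Hence the span `S`
of all jets is a representation of the affine Lie algebra, and `dim E ≤ dim S`, because a solution
is determined by its jet at one point (`exists_jetSpace`).

If `S ≠ 0`, a trace argument shows that `Q` has a kernel on `S` (`exists_ne_zero_of_comm_eq`). The
kernel is `P`-invariant and consists of jets of functions of `x¹` alone. It cannot be
two-dimensional unless the surface is of Type `A` (`isTypeA_typeB` gives an explicit chart), so it
is spanned by an eigenvector of `P`, which means that some power `(x¹)^s` is a solution
(`exists_powEq`). As `μ ≠ -1`, this forces `C₂₂¹ ≠ 0` (`PowEq.c110_ne_zero`), and a linear change of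
coordinates, under which solutions are pulled back, achieves `C₁₂¹ = 0` and `C₂₂¹ = ±1`
(`exists_normalized`). For such constants the equations for the power solution are those of the
theorem (`powEq_normalized_iff`).

If `dim S ≥ 2`, then either `S` is the whole space, which happens for `μ = -1` only
(`notMem_jetSpace`), or `S` contains a second eigenvector of `P`, of eigenvalue `s + 1`, that `Q`
maps to the first. This amounts to two more equations on the constants
(`exponent_eq_of_two_le_finrank`), under which `(x¹)^s (x² - 2 C₁₁² x¹)` is a second solution; the
two families of the theorem are the solutions of these equations (`two_dim_parameters`).
-/

open scoped ContDiff

noncomputable section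

namespace HomogeneousSurface

/-! ### Partial derivatives on the half plane -/

theorem pd_congr {f g : Plane → ℝ} (h : ∀ y ∈ halfPlane, f y = g y) (i : Fin 2) {x : Plane}
    (hx : x ∈ halfPlane) : pd i f x = pd i g x := by
  have h' : f =ᶠ[nhds x] g := by
    filter_upwards [isOpen_halfPlane.mem_nhds hx] with y hy using h y hy
  simp only [pd, h'.fderiv_eq]

theorem pd_pd_comm {f : Plane → ℝ} (hf : ContDiffOn ℝ ∞ f halfPlane) (i j : Fin 2) {x : Plane}
    (hx : x ∈ halfPlane) : pd i (pd j f) x = pd j (pd i f) x := by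
  have hd : DifferentiableAt ℝ (fderiv ℝ f) x :=
    ((hf.fderiv_of_isOpen isOpen_halfPlane (m := ∞) (by simp)).contDiffAt
      (isOpen_halfPlane.mem_nhds hx)).differentiableAt (by simp)
  have key : ∀ i j : Fin 2,
      pd i (pd j f) x = fderiv ℝ (fderiv ℝ f) x (Pi.single i 1) (Pi.single j 1) := by
    intro i j
    have := (hd.hasFDerivAt.clm_apply (hasFDerivAt_const (Pi.single j (1 : ℝ) : Plane) x)).fderiv
    simp only [pd]
    erw [this]
    simp
  rw [key, key]
  exact ((hf.contDiffAt (isOpen_halfPlane.mem_nhds hx)).isSymmSndFDerivAt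
    (by rw [minSmoothness_of_isRCLikeNormedField]; exact WithTop.coe_le_coe.2 le_top)) _ _

/-- The derivatives of a function that is affine in the second coordinate. All explicit functions
used below, as well as their derivatives, are of this form. -/
theorem pd_affine {g h : ℝ → ℝ} {g' h' : ℝ} {x : Plane} (hg : HasDerivAt g g' (x 0))
    (hh : HasDerivAt h h' (x 0)) :
    pd 0 (fun y => g (y 0) + h (y 0) * y 1) x = g' + h' * x 1 ∧
      pd 1 (fun y => g (y 0) + h (y 0) * y 1) x = h (x 0) := by
  have h0 : HasFDerivAt (fun y : Plane => y 0)
      (ContinuousLinearMap.proj (R := ℝ) (φ := fun _ : Fin 2 => ℝ) 0) x :=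
    (ContinuousLinearMap.proj (R := ℝ) (φ := fun _ : Fin 2 => ℝ) 0).hasFDerivAt
  have h1 : HasFDerivAt (fun y : Plane => y 1)
      (ContinuousLinearMap.proj (R := ℝ) (φ := fun _ : Fin 2 => ℝ) 1) x :=
    (ContinuousLinearMap.proj (R := ℝ) (φ := fun _ : Fin 2 => ℝ) 1).hasFDerivAt
  have hg1 : HasFDerivAt (fun y : Plane => g (y 0)) _ x := hg.comp_hasFDerivAt x h0
  have hh1 : HasFDerivAt (fun y : Plane => h (y 0)) _ x := hh.comp_hasFDerivAt x h0
  have := (hg1.add (hh1.mul h1)).fderiv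
  simp only [pd]
  constructor
  · erw [this]
    simp
    ring
  · erw [this]
    simp

theorem pd_inv_mul (c : ℝ) (i : Fin 2) {x : Plane} (hx : x ∈ halfPlane) :
    pd i (fun y => (y 0)⁻¹ * c) x = if i = 0 then -((x 0)⁻¹ ^ 2 * c) else 0 := by
  have hx0 : x 0 ≠ 0 := ne_of_gt hx
  have := pd_affine (x := x) ((hasDerivAt_inv hx0).mul_const c) (hasDerivAt_const (x 0) (0 : ℝ))
  simp only [zero_mul, add_zero] at this
  fin_cases i
  · simp [this.1]
  · simp [this.2]

/-! ### The symmetric Ricci tensor of a Type `B` surface -/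

/-- The Ricci tensor of `typeB C` at the points with `x¹ = 1`. -/
def Coeff.ric (C : Coeff) (j k : Fin 2) : ℝ :=
  ∑ i, ((if i = 0 then -C.c j k i else 0) - (if j = 0 then -C.c i k i else 0)
    + ∑ n, (C.c i n i * C.c j k n - C.c j n i * C.c i k n))

/-- The symmetric Ricci tensor of `typeB C` at the points with `x¹ = 1`. -/
def Coeff.symRic (C : Coeff) (i j : Fin 2) : ℝ := (C.ric i j + C.ric j i) / 2

theorem symRicci_typeB (C : Coeff) {x : Plane} (hx : x ∈ halfPlane) (i j : Fin 2) :
    symRicci (typeB C) x i j = (x 0)⁻¹ ^ 2 * C.symRic i j := by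
  have key : ∀ j k, ricci (typeB C) x j k = (x 0)⁻¹ ^ 2 * C.ric j k := by
    intro j k
    simp only [ricci, curvature, typeB, Coeff.ric, pd_inv_mul _ _ hx, Fin.sum_univ_two]
    fin_cases j <;> simp <;> ring
  rw [symRicci, key, key, Coeff.symRic]
  ring

theorem Coeff.symRic_comm (C : Coeff) (i j : Fin 2) : C.symRic i j = C.symRic j i := by
  rw [symRic, symRic, add_comm]

theorem Coeff.symRic_zero_zero (C : Coeff) : C.symRic 0 0 =
    C.c 0 1 1 * (C.c 0 0 0 - C.c 0 1 1 + 1) + C.c 0 0 1 * (C.c 1 1 1 - C.c 0 1 0) := by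
  simp [symRic, ric, Fin.sum_univ_two, C.symm 1 0]
  ring

theorem Coeff.symRic_zero_one (C : Coeff) : C.symRic 0 1 =
    C.c 0 1 0 * C.c 0 1 1 - C.c 0 0 1 * C.c 1 1 0 + (C.c 1 1 1 - C.c 0 1 0) / 2 := by
  simp [symRic, ric, Fin.sum_univ_two, C.symm 1 0]
  ring

theorem Coeff.symRic_one_one (C : Coeff) : C.symRic 1 1 =
    C.c 1 1 0 * (C.c 0 0 0 - C.c 0 1 1 - 1) + C.c 0 1 0 * (C.c 1 1 1 - C.c 0 1 0) := by
  simp [symRic, ric, Fin.sum_univ_two, C.symm 1 0]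
  ring

/-! ### Jets of solutions -/

/-- The operators by which `x¹ ∂₁` and `x¹ ∂₂` act on the jets `(f, x¹ ∂₁ f, x¹ ∂₂ f)` of solutions
`f ∈ E(μ, ∇^C)`. -/
def jetOp (C : Coeff) (μ : ℝ) (i : Fin 2) : (Fin 3 → ℝ) →ₗ[ℝ] (Fin 3 → ℝ) :=
  if i = 0 then Matrix.toLin' !![0, 1, 0; μ * C.symRic 0 0, 1 + C.c 0 0 0, C.c 0 0 1;
      μ * C.symRic 0 1, C.c 0 1 0, 1 + C.c 0 1 1]
  else Matrix.toLin' !![0, 0, 1; μ * C.symRic 0 1, C.c 0 1 0, C.c 0 1 1;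
      μ * C.symRic 1 1, C.c 1 1 0, C.c 1 1 1]

theorem jetOp_zero (C : Coeff) (μ p q r : ℝ) : jetOp C μ 0 ![p, q, r] =
    ![q, μ * C.symRic 0 0 * p + (1 + C.c 0 0 0) * q + C.c 0 0 1 * r,
      μ * C.symRic 0 1 * p + C.c 0 1 0 * q + (1 + C.c 0 1 1) * r] := by
  ext k
  fin_cases k <;> simp [jetOp, Matrix.mulVec, dotProduct, Fin.sum_univ_three]

theorem jetOp_one (C : Coeff) (μ p q r : ℝ) : jetOp C μ 1 ![p, q, r] =
    ![r, μ * C.symRic 0 1 * p + C.c 0 1 0 * q + C.c 0 1 1 * r,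
      μ * C.symRic 1 1 * p + C.c 1 1 0 * q + C.c 1 1 1 * r] := by
  ext k
  fin_cases k <;> simp [jetOp, Matrix.mulVec, dotProduct, Fin.sum_univ_three]

/-- The jet `(f, x¹ ∂₁ f, x¹ ∂₂ f)`; the weights make `jetOp` independent of the point. -/
def jet (f : Plane → ℝ) (x : Plane) : Fin 3 → ℝ := ![f x, x 0 * pd 0 f x, x 0 * pd 1 f x]

theorem contDiffOn_jet {f : Plane → ℝ} (hf : ContDiffOn ℝ ∞ f halfPlane) :
    ContDiffOn ℝ ∞ (jet f) halfPlane := by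
  have h0 : ContDiffOn ℝ ∞ (fun x : Plane => x 0) halfPlane := (contDiff_apply ℝ ℝ 0).contDiffOn
  refine contDiffOn_pi.2 fun k => ?_
  fin_cases k
  · exact hf
  · exact h0.mul (contDiffOn_pd hf 0)
  · exact h0.mul (contDiffOn_pd hf 1)

theorem pd_mul_coord {g : Plane → ℝ} (hg : ContDiffOn ℝ ∞ g halfPlane) (i : Fin 2) {x : Plane}
    (hx : x ∈ halfPlane) :
    pd i (fun y => y 0 * g y) x = x 0 * pd i g x + if i = 0 then g x else 0 := by
  have h0 : HasFDerivAt (fun y : Plane => y 0)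
      (ContinuousLinearMap.proj (R := ℝ) (φ := fun _ : Fin 2 => ℝ) 0) x :=
    (ContinuousLinearMap.proj (R := ℝ) (φ := fun _ : Fin 2 => ℝ) 0).hasFDerivAt
  have h1 := h0.mul (differentiableAt_of_contDiffOn hg hx).hasFDerivAt
  simp only [pd]
  erw [h1.fderiv]
  fin_cases i <;> simp

theorem pd_jet {C : Coeff} {μ : ℝ} {f : Plane → ℝ} (hf : f ∈ eigenspace μ (typeB C)) (i : Fin 2)
    (k : Fin 3) {x : Plane} (hx : x ∈ halfPlane) :
    pd i (fun y => jet f y k) x = (x 0)⁻¹ * jetOp C μ i (jet f x) k := by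
  obtain ⟨hs, -, he⟩ := hf
  have hx0 : x 0 ≠ 0 := ne_of_gt hx
  have e00 := he x hx 0 0
  have e01 := he x hx 0 1
  have e10 := he x hx 1 0
  have e11 := he x hx 1 1
  simp only [hessian, symRicci_typeB C hx, typeB, Fin.sum_univ_two, C.symm 1 0,
    C.symRic_comm 1 0, sub_eq_iff_eq_add] at e00 e01 e10 e11
  fin_cases i <;> fin_cases k <;>
    simp [jet, jetOp_zero, jetOp_one, pd_mul_coord (contDiffOn_pd hs _) _ hx, e00, e01, e10, e11]
      <;> field_simp <;> try ring

theorem fderiv_jet {C : Coeff} {μ : ℝ} {f : Plane → ℝ} (hf : f ∈ eigenspace μ (typeB C))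
    (i : Fin 2) {x : Plane} (hx : x ∈ halfPlane) :
    fderiv ℝ (jet f) x (Pi.single i 1) = (x 0)⁻¹ • jetOp C μ i (jet f x) := by
  have hd : DifferentiableAt ℝ (jet f) x :=
    ((contDiffOn_jet hf.1).contDiffAt (isOpen_halfPlane.mem_nhds hx)).differentiableAt (by simp)
  ext k
  have h := pd_jet hf i k hx
  simp only [pd] at h
  rw [Pi.smul_apply, smul_eq_mul, ← h, fderiv_pi (fun k => differentiableAt_pi.1 hd k)]
  simp

theorem pd_functional_jet {C : Coeff} {μ : ℝ} {f : Plane → ℝ} (hf : f ∈ eigenspace μ (typeB C))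
    (L : (Fin 3 → ℝ) →ₗ[ℝ] ℝ) (i : Fin 2) {x : Plane} (hx : x ∈ halfPlane) :
    pd i (fun y => L (jet f y)) x = (x 0)⁻¹ * L (jetOp C μ i (jet f x)) := by
  have hd : DifferentiableAt ℝ (jet f) x :=
    ((contDiffOn_jet hf.1).contDiffAt (isOpen_halfPlane.mem_nhds hx)).differentiableAt (by simp)
  have := ((LinearMap.toContinuousLinearMap L).hasFDerivAt.comp x hd.hasFDerivAt).fderiv
  simp only [pd]
  erw [this]
  simp [fderiv_jet hf i hx]

theorem contDiffOn_functional_jet {f : Plane → ℝ} (hf : ContDiffOn ℝ ∞ f halfPlane)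
    (L : (Fin 3 → ℝ) →ₗ[ℝ] ℝ) : ContDiffOn ℝ ∞ (fun y => L (jet f y)) halfPlane :=
  (LinearMap.toContinuousLinearMap L).contDiff.comp_contDiffOn (contDiffOn_jet hf)

/-- The integrability condition: the relation `[x¹ ∂₁, x¹ ∂₂] = x¹ ∂₂` on jets of solutions. -/
theorem jetOp_comm_jet {C : Coeff} {μ : ℝ} {f : Plane → ℝ} (hf : f ∈ eigenspace μ (typeB C))
    {x : Plane} (hx : x ∈ halfPlane) :
    jetOp C μ 1 (jetOp C μ 0 (jet f x)) - jetOp C μ 0 (jetOp C μ 1 (jet f x))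
      = jetOp C μ 1 (jet f x) := by
  have hx0 : x 0 ≠ 0 := ne_of_gt hx
  ext k
  let L : (Fin 3 → ℝ) →ₗ[ℝ] ℝ := LinearMap.proj k
  have hinv : ∀ (i j : Fin 2), pd i (pd j fun y => L (jet f y)) x
      = (x 0)⁻¹ * ((x 0)⁻¹ * L (jetOp C μ j (jetOp C μ i (jet f x))))
        + if i = 0 then -((x 0)⁻¹ ^ 2 * L (jetOp C μ j (jet f x))) else 0 := by
    intro i j
    rw [pd_congr (g := fun y => (y 0)⁻¹ * (L ∘ₗ jetOp C μ j) (jet f y))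
      (fun y hy => pd_functional_jet hf L j hy) i hx]
    have h0 : HasFDerivAt (fun y : Plane => y 0)
        (ContinuousLinearMap.proj (R := ℝ) (φ := fun _ : Fin 2 => ℝ) 0) x :=
      (ContinuousLinearMap.proj (R := ℝ) (φ := fun _ : Fin 2 => ℝ) 0).hasFDerivAt
    have h1 := ((hasDerivAt_inv hx0).comp_hasFDerivAt x h0).mul
      (differentiableAt_of_contDiffOn
        (contDiffOn_functional_jet hf.1 (L ∘ₗ jetOp C μ j)) hx).hasFDerivAt
    have h2 := pd_functional_jet hf (L ∘ₗ jetOp C μ j) i hx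
    simp only [pd] at h2 ⊢
    erw [h1.fderiv]
    simp only [_root_.add_apply, _root_.smul_apply, h2]
    fin_cases i <;> simp
    ring
  have h := pd_pd_comm (contDiffOn_functional_jet hf.1 L) 0 1 hx
  rw [hinv, hinv] at h
  simp only [if_true, if_neg (by decide : ¬ (1 : Fin 2) = 0), L, LinearMap.proj_apply] at h
  field_simp at h
  simp only [Pi.sub_apply]
  linarith

/-- A solution is determined by its jet at one point, as the jet solves a linear differential
equation along segments. -/
theorem eq_zero_of_jet_eq_zero {C : Coeff} {μ : ℝ} {f : Plane → ℝ}
    (hf : f ∈ eigenspace μ (typeB C)) {p : Plane} (hp : p ∈ halfPlane) (h : jet f p = 0) :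
    f = 0 := by
  funext x
  by_cases hx : x ∈ halfPlane
  swap
  · exact hf.2.1 x hx
  set γ : ℝ → Plane := fun t => p + t • (x - p) with hγ
  have hm : 0 < min (p 0) (x 0) := lt_min hp hx
  have hγ0 : ∀ t ∈ Set.Icc (0 : ℝ) 1, min (p 0) (x 0) ≤ γ t 0 := by
    intro t ht
    have h1 : γ t 0 = (1 - t) * p 0 + t * x 0 := by simp [hγ]; ring
    have h2 := mul_le_mul_of_nonneg_left (min_le_left (p 0) (x 0)) (sub_nonneg.2 ht.2)
    have h3 := mul_le_mul_of_nonneg_left (min_le_right (p 0) (x 0)) ht.1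
    rw [h1]; linarith
  have hγm : ∀ t ∈ Set.Icc (0 : ℝ) 1, γ t ∈ halfPlane := fun t ht =>
    lt_of_lt_of_le hm (hγ0 t ht)
  have hd : ∀ t, HasDerivAt γ (x - p) t := fun t => by
    simpa [hγ] using ((hasDerivAt_id t).smul_const (x - p)).const_add p
  set A : (Fin 3 → ℝ) →L[ℝ] (Fin 3 → ℝ) := LinearMap.toContinuousLinearMap
    ((x 0 - p 0) • jetOp C μ 0 + (x 1 - p 1) • jetOp C μ 1) with hA
  have hdj : ∀ t ∈ Set.Icc (0 : ℝ) 1,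
      HasDerivAt (fun t => jet f (γ t)) ((γ t 0)⁻¹ • A (jet f (γ t))) t := by
    intro t ht
    have hdf : DifferentiableAt ℝ (jet f) (γ t) :=
      ((contDiffOn_jet hf.1).contDiffAt
        (isOpen_halfPlane.mem_nhds (hγm t ht))).differentiableAt (by simp)
    have h1 := hdf.hasFDerivAt.comp_hasDerivAt t (hd t)
    have h2 : x - p = (x 0 - p 0) • Pi.single 0 (1 : ℝ) + (x 1 - p 1) • Pi.single 1 (1 : ℝ) := by
      ext i
      fin_cases i <;> simp
    rw [h2, map_add, map_smul, map_smul, fderiv_jet hf 0 (hγm t ht), fderiv_jet hf 1 (hγm t ht)]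
      at h1
    have h3 : (γ t 0)⁻¹ • A (jet f (γ t)) = (x 0 - p 0) • (γ t 0)⁻¹ • jetOp C μ 0 (jet f (γ t))
        + (x 1 - p 1) • (γ t 0)⁻¹ • jetOp C μ 1 (jet f (γ t)) := by
      rw [hA, LinearMap.coe_toContinuousLinearMap', LinearMap.add_apply, LinearMap.smul_apply,
        LinearMap.smul_apply, smul_add, smul_comm, smul_comm (γ t 0)⁻¹ (x 1 - p 1)]
    rw [h3]
    exact h1
  have hz := eq_zero_of_abs_deriv_le_mul_abs_self_of_eq_zero_right (a := 0) (b := 1)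
    (f := fun t => jet f (γ t)) (f' := fun t => (γ t 0)⁻¹ • A (jet f (γ t)))
    (K := (min (p 0) (x 0))⁻¹ * ‖A‖)
    (fun t ht => (hdj t ht).continuousAt.continuousWithinAt)
    (fun t ht => (hdj t (Set.Ico_subset_Icc_self ht)).hasDerivWithinAt)
    (by simpa [hγ] using h)
    (fun t ht => by
      have ht' := Set.Ico_subset_Icc_self ht
      rw [norm_smul, mul_assoc]
      refine mul_le_mul ?_ (A.le_opNorm _) (norm_nonneg _) (inv_nonneg.2 hm.le)
      rw [Real.norm_of_nonneg (inv_nonneg.2 (hm.le.trans (hγ0 t ht')))]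
      exact inv_anti₀ hm (hγ0 t ht'))
    1 (by simp)
  have := congrFun hz 0
  simpa [hγ, jet] using this

/-- The jets of solutions lie in a space that is invariant under the jet operators and on which
these satisfy the relation of the affine Lie algebra; its dimension bounds that of `E(μ, ∇^C)`. -/
theorem exists_jetSpace (C : Coeff) (μ : ℝ) : ∃ S : Submodule ℝ (Fin 3 → ℝ),
    Module.rank ℝ (eigenspace μ (typeB C)) ≤ Module.finrank ℝ S ∧
    (∀ i, ∀ w ∈ S, jetOp C μ i w ∈ S) ∧
    ∀ w ∈ S, jetOp C μ 1 (jetOp C μ 0 w) - jetOp C μ 0 (jetOp C μ 1 w) = jetOp C μ 1 w := by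
  let T : Set (Fin 3 → ℝ) := {w | ∃ f ∈ eigenspace μ (typeB C), ∃ x ∈ halfPlane, jet f x = w}
  refine ⟨Submodule.span ℝ T, ?_, ?_, ?_⟩
  · have hp : (![1, 0] : Plane) ∈ halfPlane := by simp [halfPlane]
    let J : eigenspace μ (typeB C) →ₗ[ℝ] Submodule.span ℝ T :=
      { toFun := fun f => ⟨jet f.1 ![1, 0], Submodule.subset_span ⟨f.1, f.2, _, hp, rfl⟩⟩
        map_add' := fun f g => by
          ext k
          fin_cases k <;> simp [jet, pd_add f.2.1 g.2.1 _ hp]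
        map_smul' := fun a f => by
          ext k
          fin_cases k <;> simp [jet, pd_smul] }
    have hJ : Function.Injective J := by
      rw [← LinearMap.ker_eq_bot, LinearMap.ker_eq_bot']
      intro f hf
      exact Subtype.ext (eq_zero_of_jet_eq_zero f.2 hp (congrArg Subtype.val hf))
    rw [Module.finrank_eq_rank]
    exact LinearMap.rank_le_of_injective J hJ
  · intro i w hw
    by_contra hn
    obtain ⟨L, hL, hLT⟩ := Submodule.exists_le_ker_of_notMem hn
    refine hL ?_
    have : Submodule.span ℝ T ≤ LinearMap.ker (L ∘ₗ jetOp C μ i) := by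
      refine Submodule.span_le.2 ?_
      rintro _ ⟨f, hf, x, hx, rfl⟩
      have h1 := pd_functional_jet hf L i hx
      rw [pd_congr (g := fun _ => 0) (fun y hy => hLT (Submodule.subset_span ⟨f, hf, y, hy, rfl⟩))
        i hx] at h1
      have hx0 : x 0 ≠ 0 := ne_of_gt hx
      simpa [pd, hx0] using h1.symm
    exact this hw
  · intro w hw
    have : Submodule.span ℝ T ≤ LinearMap.ker
        (jetOp C μ 1 ∘ₗ jetOp C μ 0 - jetOp C μ 0 ∘ₗ jetOp C μ 1 - jetOp C μ 1) := by
      refine Submodule.span_le.2 ?_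
      rintro _ ⟨f, hf, x, hx, rfl⟩
      simpa [sub_eq_zero] using jetOp_comm_jet hf hx
    simpa [sub_eq_zero] using this hw

/-! ### Explicit solutions -/

/-- The functions `(x¹)^s (l + k x¹ + m x²)`, extended by `0`. -/
def powSol (s l k m : ℝ) (x : Plane) : ℝ :=
  if 0 < x 0 then x 0 ^ s * (l + k * x 0) + m * x 0 ^ s * x 1 else 0

theorem powSol_mem {C : Coeff} {μ s l k m : ℝ}
    (h00 : s * (s - 1) - C.c 0 0 0 * s = μ * C.symRic 0 0)
    (h01 : -(C.c 0 1 0 * s) = μ * C.symRic 0 1) (h11 : -(C.c 1 1 0 * s) = μ * C.symRic 1 1)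
    (k00 : (s + 1) * s * k - C.c 0 0 0 * (s + 1) * k - C.c 0 0 1 * m = μ * C.symRic 0 0 * k)
    (k01 : s * m - C.c 0 1 0 * (s + 1) * k - C.c 0 1 1 * m = μ * C.symRic 0 1 * k)
    (k11 : -(C.c 1 1 0 * (s + 1) * k) - C.c 1 1 1 * m = μ * C.symRic 1 1 * k) :
    powSol s l k m ∈ eigenspace μ (typeB C) := by
  have hp : ∀ t : ℝ, 0 < t → HasDerivAt (fun t : ℝ => t ^ s) (t ^ s * (s * t⁻¹)) t := by
    intro t ht
    convert Real.hasDerivAt_rpow_const (p := s) (Or.inl ht.ne') using 1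
    rw [Real.rpow_sub_one ht.ne']
    ring
  have hi : ∀ t : ℝ, 0 < t → HasDerivAt (fun t : ℝ => t⁻¹) (-(t ^ 2)⁻¹) t := fun t ht =>
    hasDerivAt_inv ht.ne'
  have hpow : ContDiffOn ℝ ∞ (fun x : Plane => x 0 ^ s) halfPlane :=
    (contDiff_apply ℝ ℝ (0 : Fin 2)).contDiffOn.rpow_const_of_ne fun x hx => ne_of_gt hx
  have h0 : ContDiffOn ℝ ∞ (fun x : Plane => x 0) halfPlane := (contDiff_apply ℝ ℝ 0).contDiffOn
  have h1 : ContDiffOn ℝ ∞ (fun x : Plane => x 1) halfPlane := (contDiff_apply ℝ ℝ 1).contDiffOn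
  have e : ∀ y ∈ halfPlane, powSol s l k m y
      = y 0 ^ s * (l + k * y 0) + m * y 0 ^ s * y 1 := fun y hy => if_pos hy
  have d : ∀ y ∈ halfPlane,
      pd 0 (powSol s l k m) y = y 0 ^ s * (s * l * (y 0)⁻¹ + (s + 1) * k)
        + m * y 0 ^ s * (s * (y 0)⁻¹) * y 1 ∧ pd 1 (powSol s l k m) y = m * y 0 ^ s := by
    intro y hy
    have hy0 : y 0 ≠ 0 := ne_of_gt hy
    have := pd_affine (x := y) ((hp _ hy).mul (((hasDerivAt_id' (y 0)).const_mul k).const_add l))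
      ((hp _ hy).const_mul m)
    rw [pd_congr e 0 hy, pd_congr e 1 hy]
    refine ⟨this.1.trans ?_, this.2⟩
    field_simp
    ring
  refine ⟨?_, fun x hx => if_neg hx, ?_⟩
  · exact ((hpow.mul (contDiffOn_const.add (contDiffOn_const.mul h0))).add
      ((contDiffOn_const.mul hpow).mul h1)).congr e
  · intro x hx
    have hx0 : x 0 ≠ 0 := ne_of_gt hx
    have a := pd_affine (x := x)
      ((hp _ hx).mul (((hi _ hx).const_mul (s * l)).add_const ((s + 1) * k)))
      (((hp _ hx).const_mul m).mul ((hi _ hx).const_mul s))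
    have b := pd_affine (x := x) ((hp _ hx).const_mul m) (hasDerivAt_const (x 0) (0 : ℝ))
    simp only [zero_mul, add_zero] at b
    have a0 := (pd_congr (fun y hy => (d y hy).1) 0 hx).trans a.1
    have a1 := (pd_congr (fun y hy => (d y hy).1) 1 hx).trans a.2
    have b0 := (pd_congr (fun y hy => (d y hy).2) 0 hx).trans b.1
    have b1 := (pd_congr (fun y hy => (d y hy).2) 1 hx).trans b.2
    intro i j
    rw [symRicci_typeB C hx, e x hx]
    fin_cases i <;> fin_cases j <;>
      simp [hessian, typeB, Fin.sum_univ_two, d x hx, a0, a1, b0, b1, C.symm 1 0,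
        C.symRic_comm 1 0] <;> field_simp
    · linear_combination x 0 ^ s * ((l + m * x 1) * h00 + x 0 * k00)
    · linear_combination x 0 ^ s * ((l + m * x 1) * h01 + x 0 * k01)
    · linear_combination x 0 ^ s * ((l + m * x 1) * h01 + x 0 * k01)
    · linear_combination x 0 ^ s * ((l + m * x 1) * h11 + x 0 * k11)

/-! ### Linear equivalence -/

/-- The relation between the constants of two Type `B` surfaces that are intertwined by
`(x¹, x²) ↦ (x¹, a x¹ + b x²)`. -/
structure ShearRel (a b : ℝ) (C D : Coeff) : Prop where
  h000 : C.c 0 0 0 = D.c 0 0 0 + 2 * a * D.c 0 1 0 + a ^ 2 * D.c 1 1 0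
  h010 : C.c 0 1 0 = b * (D.c 0 1 0 + a * D.c 1 1 0)
  h110 : C.c 1 1 0 = b ^ 2 * D.c 1 1 0
  h001 : a * C.c 0 0 0 + b * C.c 0 0 1 = D.c 0 0 1 + 2 * a * D.c 0 1 1 + a ^ 2 * D.c 1 1 1
  h011 : a * C.c 0 1 0 + b * C.c 0 1 1 = b * (D.c 0 1 1 + a * D.c 1 1 1)
  h111 : a * C.c 1 1 0 + b * C.c 1 1 1 = b ^ 2 * D.c 1 1 1

theorem intertwines_shear_iff {a b : ℝ} {C D : Coeff} :
    Intertwines halfPlane (fun x => ![x 0, a * x 0 + b * x 1]) (typeB C) (typeB D)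
      ↔ ShearRel a b C D := by
  have p0 : ∀ x : Plane, pd 0 (fun y : Plane => y 0) x = 1 ∧ pd 1 (fun y : Plane => y 0) x = 0 := by
    intro x
    simpa using pd_affine (x := x) (hasDerivAt_id' (x 0)) (hasDerivAt_const (x 0) (0 : ℝ))
  have p1 : ∀ x : Plane, pd 0 (fun y : Plane => a * y 0 + b * y 1) x = a
      ∧ pd 1 (fun y : Plane => a * y 0 + b * y 1) x = b := by
    intro x
    simpa using pd_affine (x := x) ((hasDerivAt_id' (x 0)).const_mul a) (hasDerivAt_const (x 0) b)
  have q0 : pd 0 (fun y : Plane => y 0) = (fun _ => 1) ∧ pd 1 (fun y : Plane => y 0) = fun _ => 0 :=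
    ⟨funext fun x => (p0 x).1, funext fun x => (p0 x).2⟩
  have q1 : pd 0 (fun y : Plane => a * y 0 + b * y 1) = (fun _ => a)
      ∧ pd 1 (fun y : Plane => a * y 0 + b * y 1) = fun _ => b :=
    ⟨funext fun x => (p1 x).1, funext fun x => (p1 x).2⟩
  have qc : ∀ (i : Fin 2) (r : ℝ) (x : Plane), pd i (fun _ => r) x = 0 := by
    intro i r x
    simp [pd]
  constructor
  · intro h
    have h := h ![1, 0] (by simp [halfPlane])
    have e1 := h 0 0 0
    have e2 := h 0 1 0
    have e3 := h 1 1 0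
    have e4 := h 0 0 1
    have e5 := h 0 1 1
    have e6 := h 1 1 1
    simp [q0, q1, qc, typeB, Fin.sum_univ_two, D.symm 1 0] at e1 e2 e3 e4 e5 e6
    constructor
    · linear_combination -e1
    · linear_combination -e2
    · linear_combination -e3
    · linear_combination -e4
    · linear_combination -e5
    · linear_combination -e6
  · rintro ⟨e1, e2, e3, e4, e5, e6⟩ x - i j c
    fin_cases i <;> fin_cases j <;> fin_cases c <;>
      simp [q0, q1, qc, typeB, Fin.sum_univ_two, D.symm 1 0, C.symm 1 0]
    · linear_combination -(x 0)⁻¹ * e1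
    · linear_combination -(x 0)⁻¹ * e4
    · linear_combination -(x 0)⁻¹ * e2
    · linear_combination -(x 0)⁻¹ * e5
    · linear_combination -(x 0)⁻¹ * e2
    · linear_combination -(x 0)⁻¹ * e5
    · linear_combination -(x 0)⁻¹ * e3
    · linear_combination -(x 0)⁻¹ * e6

theorem linearlyEquivalent_iff {C D : Coeff} :
    LinearlyEquivalent C D ↔ ∃ a b : ℝ, b ≠ 0 ∧ ShearRel a b C D := by
  simp only [LinearlyEquivalent, intertwines_shear_iff]

theorem ShearRel.symm {a b : ℝ} {C D : Coeff} (hb : b ≠ 0) (h : ShearRel a b C D) :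
    ShearRel (-(a / b)) b⁻¹ D C := by
  obtain ⟨e1, e2, e3, e4, e5, e6⟩ := h
  constructor
  · rw [e1, e2, e3]; field_simp; ring
  · rw [e2, e3]; field_simp; ring
  · rw [e3]; field_simp
  · linear_combination (norm := (field_simp; ring)) -(1 / b) * e4 + 2 * a / b ^ 2 * e5
      - a ^ 2 / b ^ 3 * e6 + a / b * e1 - 2 * a ^ 2 / b ^ 2 * e2 + a ^ 3 / b ^ 3 * e3
  · linear_combination (norm := (field_simp; ring)) -(1 / b ^ 2) * e5 + a / b ^ 3 * e6
      + a / b ^ 2 * e2 - a ^ 2 / b ^ 3 * e3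
  · linear_combination (norm := (field_simp; ring)) -(1 / b ^ 3) * e6 + a / b ^ 3 * e3

theorem LinearlyEquivalent.symm {C D : Coeff} (h : LinearlyEquivalent C D) :
    LinearlyEquivalent D C := by
  obtain ⟨a, b, hb, h⟩ := linearlyEquivalent_iff.1 h
  exact linearlyEquivalent_iff.2 ⟨_, _, inv_ne_zero hb, h.symm hb⟩

/-- The symmetric Ricci tensor is a tensor. -/
theorem ShearRel.symRic {a b : ℝ} {C D : Coeff} (hb : b ≠ 0) (h : ShearRel a b C D) :
    C.symRic 0 0 = D.symRic 0 0 + 2 * a * D.symRic 0 1 + a ^ 2 * D.symRic 1 1 ∧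
    C.symRic 0 1 = b * (D.symRic 0 1 + a * D.symRic 1 1) ∧
    C.symRic 1 1 = b ^ 2 * D.symRic 1 1 := by
  obtain ⟨e1, e2, e3, e4, e5, e6⟩ := h
  have e6' : C.c 1 1 1 = (b ^ 2 * D.c 1 1 1 - a * C.c 1 1 0) / b := by
    field_simp; linear_combination e6
  have e5' : C.c 0 1 1 = (b * (D.c 0 1 1 + a * D.c 1 1 1) - a * C.c 0 1 0) / b := by
    field_simp; linear_combination e5
  have e4' : C.c 0 0 1
      = (D.c 0 0 1 + 2 * a * D.c 0 1 1 + a ^ 2 * D.c 1 1 1 - a * C.c 0 0 0) / b := by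
    field_simp; linear_combination e4
  simp only [Coeff.symRic_zero_zero, Coeff.symRic_zero_one, Coeff.symRic_one_one, e4', e5', e6',
    e1, e2, e3]
  refine ⟨?_, ?_, ?_⟩ <;> field_simp <;> ring

/-- The linear map `(x¹, x²) ↦ (x¹, a x¹ + b x²)`. -/
def shear (a b : ℝ) : Plane →L[ℝ] Plane :=
  LinearMap.toContinuousLinearMap (Matrix.toLin' !![1, 0; a, b])

theorem shear_apply (a b : ℝ) (x : Plane) : shear a b x = ![x 0, a * x 0 + b * x 1] := by
  ext i
  fin_cases i <;> simp [shear, Matrix.mulVec, dotProduct, Fin.sum_univ_two]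

theorem shear_mem_halfPlane (a b : ℝ) (x : Plane) : shear a b x ∈ halfPlane ↔ x ∈ halfPlane := by
  simp [halfPlane, shear_apply]

theorem pd_comp_shear {f : Plane → ℝ} (hf : ContDiffOn ℝ ∞ f halfPlane) (a b : ℝ) {x : Plane}
    (hx : x ∈ halfPlane) :
    pd 0 (f ∘ shear a b) x = pd 0 f (shear a b x) + a * pd 1 f (shear a b x) ∧
      pd 1 (f ∘ shear a b) x = b * pd 1 f (shear a b x) := by
  have h := ((differentiableAt_of_contDiffOn hf
    ((shear_mem_halfPlane a b x).2 hx)).hasFDerivAt.comp x (shear a b).hasFDerivAt).fderiv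
  have s0 : shear a b (Pi.single 0 1) = Pi.single 0 1 + a • Pi.single 1 1 := by
    rw [shear_apply]
    ext i
    fin_cases i <;> simp
  have s1 : shear a b (Pi.single 1 1) = b • Pi.single 1 1 := by
    rw [shear_apply]
    ext i
    fin_cases i <;> simp
  simp only [pd]
  rw [h]
  simp [s0, s1]

theorem comp_shear_mem {a b : ℝ} (hb : b ≠ 0) {C D : Coeff} (h : ShearRel a b C D) {μ : ℝ}
    {f : Plane → ℝ} (hf : f ∈ eigenspace μ (typeB D)) :
    f ∘ shear a b ∈ eigenspace μ (typeB C) := by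
  obtain ⟨hs, h0, he⟩ := hf
  refine ⟨hs.comp (shear a b).contDiff.contDiffOn fun x hx => (shear_mem_halfPlane a b x).2 hx,
    fun x hx => h0 _ fun hx' => hx ((shear_mem_halfPlane a b x).1 hx'), ?_⟩
  intro x hx
  have hx' := (shear_mem_halfPlane a b x).2 hx
  have c0 := contDiffOn_pd hs 0
  have c1 := contDiffOn_pd hs 1
  have d0 : ∀ i, pd i (pd 0 (f ∘ shear a b)) x
      = pd i (pd 0 f ∘ shear a b) x + a * pd i (pd 1 f ∘ shear a b) x := by
    intro i
    rw [pd_congr (g := pd 0 f ∘ shear a b + a • (pd 1 f ∘ shear a b))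
      (fun y hy => (pd_comp_shear hs a b hy).1) i hx, pd_add _ _ i hx, pd_smul]
    · exact c0.comp (shear a b).contDiff.contDiffOn fun x hx => (shear_mem_halfPlane a b x).2 hx
    · exact contDiffOn_const.smul
        (c1.comp (shear a b).contDiff.contDiffOn fun x hx => (shear_mem_halfPlane a b x).2 hx)
  have d1 : ∀ i, pd i (pd 1 (f ∘ shear a b)) x = b * pd i (pd 1 f ∘ shear a b) x := by
    intro i
    rw [pd_congr (g := b • (pd 1 f ∘ shear a b))
      (fun y hy => (pd_comp_shear hs a b hy).2) i hx, pd_smul]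
  obtain ⟨r00, r01, r11⟩ := h.symRic hb
  obtain ⟨e1, e2, e3, e4, e5, e6⟩ := h
  have E00 := he _ hx' 0 0
  have E01 := he _ hx' 0 1
  have E10 := he _ hx' 1 0
  have E11 := he _ hx' 1 1
  have hsx : shear a b x 0 = x 0 := by simp [shear_apply]
  simp only [hessian, symRicci_typeB D hx', typeB, Fin.sum_univ_two, D.symm 1 0,
    D.symRic_comm 1 0, hsx] at E00 E01 E10 E11
  set y := shear a b x
  intro i j
  fin_cases i <;> fin_cases j <;>
    simp only [hessian, symRicci_typeB C hx, typeB, Fin.sum_univ_two, C.symm 1 0,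
      C.symRic_comm 1 0, d0, d1, (pd_comp_shear hs a b hx).1, (pd_comp_shear hs a b hx).2,
      (pd_comp_shear c0 a b hx).1, (pd_comp_shear c0 a b hx).2, (pd_comp_shear c1 a b hx).1,
      (pd_comp_shear c1 a b hx).2, Fin.zero_eta, Fin.mk_one, Fin.isValue, Function.comp_apply, r00,
      r01, r11]
  · linear_combination E00 + a * E01 + a * E10 + a ^ 2 * E11
      - (x 0)⁻¹ * pd 0 f y * e1 - (x 0)⁻¹ * pd 1 f y * e4
  · linear_combination b * E01 + a * b * E11
      - (x 0)⁻¹ * pd 0 f y * e2 - (x 0)⁻¹ * pd 1 f y * e5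
  · linear_combination b * E10 + a * b * E11
      - (x 0)⁻¹ * pd 0 f y * e2 - (x 0)⁻¹ * pd 1 f y * e5
  · linear_combination b ^ 2 * E11
      - (x 0)⁻¹ * pd 0 f y * e3 - (x 0)⁻¹ * pd 1 f y * e6

theorem rank_eigenspace_le {C D : Coeff} (h : LinearlyEquivalent C D) (μ : ℝ) :
    Module.rank ℝ (eigenspace μ (typeB D)) ≤ Module.rank ℝ (eigenspace μ (typeB C)) := by
  obtain ⟨a, b, hb, h⟩ := linearlyEquivalent_iff.1 h
  let J : eigenspace μ (typeB D) →ₗ[ℝ] eigenspace μ (typeB C) :=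
    { toFun := fun f => ⟨f.1 ∘ shear a b, comp_shear_mem hb h f.2⟩
      map_add' := fun f g => rfl
      map_smul' := fun r f => rfl }
  refine LinearMap.rank_le_of_injective J fun f g hfg => Subtype.ext (funext fun x => ?_)
  have hs : shear a b ![x 0, (x 1 - a * x 0) / b] = x := by
    rw [shear_apply]
    ext i
    fin_cases i
    · simp
    · simp
      field_simp
      ring
  have := congrFun (congrArg Subtype.val hfg) ![x 0, (x 1 - a * x 0) / b]
  simpa [J, hs] using this

theorem rank_eigenspace_eq {C D : Coeff} (h : LinearlyEquivalent C D) (μ : ℝ) :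
    Module.rank ℝ (eigenspace μ (typeB C)) = Module.rank ℝ (eigenspace μ (typeB D)) :=
  (rank_eigenspace_le h.symm μ).antisymm (rank_eigenspace_le h μ)

/-- If `C₂₂¹ ≠ 0`, a linear change of coordinates achieves `C₁₂¹ = 0` and `C₂₂¹ = ±1`. -/
theorem exists_normalized {C : Coeff} (h : C.c 1 1 0 ≠ 0) : ∃ (D : Coeff) (ε : ℝ),
    LinearlyEquivalent C D ∧ (ε = 1 ∨ ε = -1) ∧ D.c 0 1 0 = 0 ∧ D.c 1 1 0 = ε := by
  obtain ⟨b, ε, hb, hε, hC⟩ : ∃ b ε : ℝ, b ≠ 0 ∧ (ε = 1 ∨ ε = -1) ∧ C.c 1 1 0 = b ^ 2 * ε := by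
    rcases lt_or_gt_of_ne h with h | h
    · refine ⟨√(-C.c 1 1 0), -1, (Real.sqrt_pos.2 (by linarith)).ne', Or.inr rfl, ?_⟩
      rw [Real.sq_sqrt (by linarith)]
      ring
    · refine ⟨√(C.c 1 1 0), 1, (Real.sqrt_pos.2 h).ne', Or.inl rfl, ?_⟩
      rw [Real.sq_sqrt h.le]
      ring
  have hε2 : ε * ε = 1 := by rcases hε with rfl | rfl <;> norm_num
  obtain ⟨a, ha⟩ : ∃ a, a = ε * C.c 0 1 0 / b := ⟨_, rfl⟩
  obtain ⟨d111, hd111⟩ : ∃ d, d = (a * C.c 1 1 0 + b * C.c 1 1 1) / b ^ 2 := ⟨_, rfl⟩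
  obtain ⟨d011, hd011⟩ : ∃ d, d = (a * C.c 0 1 0 + b * C.c 0 1 1) / b - a * d111 := ⟨_, rfl⟩
  let D : Coeff := ⟨![![![C.c 0 0 0 - a ^ 2 * ε,
      a * C.c 0 0 0 + b * C.c 0 0 1 - 2 * a * d011 - a ^ 2 * d111], ![0, d011]],
      ![![0, d011], ![ε, d111]]], by
    intro i j k
    fin_cases i <;> fin_cases j <;> rfl⟩
  refine ⟨D, ε, linearlyEquivalent_iff.2 ⟨a, b, hb, ?_⟩, hε, rfl, rfl⟩
  constructor <;> simp [D]
  · rw [ha]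
    field_simp
    linear_combination -C.c 0 1 0 * hε2
  · exact hC
  · ring
  · rw [hd011]
    field_simp
    ring
  · rw [hd111]
    field_simp

/-! ### Type `B` surfaces that are also of Type `A` -/

/-- The surface is of Type `A` in the global chart `(log x¹, x² + k x¹ + m x¹ log x¹)`; the second
coordinate is chosen so as to eliminate `C₁₁²`. -/
theorem isTypeA_typeB {C : Coeff} (h010 : C.c 0 1 0 = 0) (h110 : C.c 1 1 0 = 0)
    (h111 : C.c 1 1 1 = 0) : IsTypeA (typeB C) := by
  obtain ⟨k, m, hkm, hm⟩ : ∃ k m : ℝ,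
      k * (2 * C.c 0 1 1 - C.c 0 0 0) + m * (1 + 2 * C.c 0 1 1 - C.c 0 0 0) = C.c 0 0 1 ∧
      m * (2 * C.c 0 1 1 - C.c 0 0 0) = 0 := by
    by_cases h : 2 * C.c 0 1 1 - C.c 0 0 0 = 0
    · exact ⟨0, C.c 0 0 1, by linear_combination C.c 0 0 1 * h, by rw [h, mul_zero]⟩
    · exact ⟨C.c 0 0 1 / (2 * C.c 0 1 1 - C.c 0 0 0), 0, by field_simp; ring, by ring⟩
  have hl : ContDiffOn ℝ ∞ (fun x : Plane => Real.log (x 0)) halfPlane :=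
    (contDiff_apply ℝ ℝ (0 : Fin 2)).contDiffOn.log fun x hx => ne_of_gt hx
  have h0 : ContDiff ℝ ∞ (fun x : Plane => x 0) := contDiff_apply ℝ ℝ 0
  have h1 : ContDiff ℝ ∞ (fun x : Plane => x 1) := contDiff_apply ℝ ℝ 1
  let φ₀ : Plane → Plane := fun x =>
    ![Real.log (x 0), k * x 0 + m * (x 0 * Real.log (x 0)) + 1 * x 1]
  let ψ₀ : Plane → Plane := fun z =>
    ![Real.exp (z 0), z 1 - (k * Real.exp (z 0) + m * (Real.exp (z 0) * z 0))]
  have hφ : ContDiffOn ℝ ∞ φ₀ halfPlane := by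
    refine contDiffOn_pi.2 fun i => ?_
    fin_cases i
    · exact hl
    · exact ((contDiffOn_const.mul h0.contDiffOn).add
        (contDiffOn_const.mul (h0.contDiffOn.mul hl))).add (contDiffOn_const.mul h1.contDiffOn)
  have hψ : ContDiff ℝ ∞ ψ₀ := by
    refine contDiff_pi.2 fun i => ?_
    fin_cases i
    · exact h0.exp
    · exact h1.sub ((contDiff_const.mul h0.exp).add (contDiff_const.mul (h0.exp.mul h0)))
  let φ : OpenPartialHomeomorph Plane Plane :=
    { toFun := φ₀
      invFun := ψ₀
      source := halfPlane
      target := Set.univ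
      map_source' := fun _ _ => trivial
      map_target' := fun z _ => Real.exp_pos (z 0)
      left_inv' := fun x hx => by
        ext i
        fin_cases i <;> simp [φ₀, ψ₀, Real.exp_log (show 0 < x 0 from hx)]
      right_inv' := fun z _ => by
        ext i
        fin_cases i <;> simp [φ₀, ψ₀]
      open_source := isOpen_halfPlane
      open_target := isOpen_univ
      continuousOn_toFun := hφ.continuousOn
      continuousOn_invFun := hψ.continuous.continuousOn }
  let A : Coeff := ⟨![![![1 + C.c 0 0 0, 0], ![0, C.c 0 1 1]], ![![0, C.c 0 1 1], ![0, 0]]], by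
    intro i j k
    fin_cases i <;> fin_cases j <;> rfl⟩
  refine fun p hp => ⟨φ, hp, subset_rfl, hφ, hψ.contDiffOn, A, ?_⟩
  have p0 : ∀ x ∈ halfPlane, pd 0 (fun y : Plane => Real.log (y 0)) x = (x 0)⁻¹
      ∧ pd 1 (fun y : Plane => Real.log (y 0)) x = 0 := by
    intro x hx
    simpa using pd_affine (x := x) (Real.hasDerivAt_log (ne_of_gt hx))
      (hasDerivAt_const (x 0) (0 : ℝ))
  have p1 : ∀ x ∈ halfPlane,
      pd 0 (fun y : Plane => k * y 0 + m * (y 0 * Real.log (y 0)) + 1 * y 1) x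
        = k + m * (Real.log (x 0) + 1)
      ∧ pd 1 (fun y : Plane => k * y 0 + m * (y 0 * Real.log (y 0)) + 1 * y 1) x = 1 := by
    intro x hx
    have hx0 : x 0 ≠ 0 := ne_of_gt hx
    simpa [hx0] using pd_affine (x := x) (((hasDerivAt_id' (x 0)).const_mul k).add
      (((hasDerivAt_id' (x 0)).mul (Real.hasDerivAt_log hx0)).const_mul m))
      (hasDerivAt_const (x 0) (1 : ℝ))
  have qc : ∀ (i : Fin 2) (r : ℝ) (x : Plane), pd i (fun _ => r) x = 0 := by
    intro i r x
    simp [pd]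
  intro x hx i j c
  have hx0 : x 0 ≠ 0 := ne_of_gt hx
  have hx' : x ∈ halfPlane := hx
  have q00 : pd 0 (pd 0 fun y : Plane => Real.log (y 0)) x = -(x 0 ^ 2)⁻¹
      ∧ pd 1 (pd 0 fun y : Plane => Real.log (y 0)) x = 0 := by
    rw [pd_congr (fun y hy => (p0 y hy).1) 0 hx, pd_congr (fun y hy => (p0 y hy).1) 1 hx]
    simpa using pd_affine (x := x) (hasDerivAt_inv hx0) (hasDerivAt_const (x 0) (0 : ℝ))
  have q01 : ∀ i, pd i (pd 1 fun y : Plane => Real.log (y 0)) x = 0 := fun i => by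
    rw [pd_congr (fun y hy => (p0 y hy).2) i hx, qc]
  have q10 : pd 0 (pd 0 fun y : Plane => k * y 0 + m * (y 0 * Real.log (y 0)) + 1 * y 1) x
        = m * (x 0)⁻¹
      ∧ pd 1 (pd 0 fun y : Plane => k * y 0 + m * (y 0 * Real.log (y 0)) + 1 * y 1) x = 0 := by
    rw [pd_congr (fun y hy => (p1 y hy).1) 0 hx, pd_congr (fun y hy => (p1 y hy).1) 1 hx]
    simpa using pd_affine (x := x) ((((Real.hasDerivAt_log hx0).add_const 1).const_mul m).const_add k)
      (hasDerivAt_const (x 0) (0 : ℝ))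
  have q11 : ∀ i,
      pd i (pd 1 fun y : Plane => k * y 0 + m * (y 0 * Real.log (y 0)) + 1 * y 1) x = 0 :=
    fun i => by rw [pd_congr (fun y hy => (p1 y hy).2) i hx, qc]
  change pd i (pd j (fun y => φ₀ y c)) x + ∑ a, ∑ b, A.c a b c * pd i (fun y => φ₀ y a) x
    * pd j (fun y => φ₀ y b) x = ∑ n, typeB C x i j n * pd n (fun y => φ₀ y c) x
  fin_cases i <;> fin_cases j <;> fin_cases c <;>
    simp [φ₀, A, typeB, Fin.sum_univ_two, C.symm 1 0, p0 x hx, p1 x hx, q00, q01, q10, q11,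
      h010, h110, h111, -one_mul]
  · field_simp
    ring
  · field_simp
    linear_combination hkm + Real.log (x 0) * hm
  · ring
  · ring

/-! ### The algebra of the jet space -/

/-- If `[Q, P] = Q` on a nonzero finite-dimensional space, then `Q` is not injective: otherwise
`P - Q⁻¹ P Q = 1`, and taking traces gives dimension `0`. -/
theorem exists_ne_zero_of_comm_eq {V : Type*} [AddCommGroup V] [Module ℝ V]
    [FiniteDimensional ℝ V] [Nontrivial V] (P Q : V →ₗ[ℝ] V)
    (h : ∀ v, Q (P v) - P (Q v) = Q v) : ∃ v, v ≠ 0 ∧ Q v = 0 := by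
  by_contra! hn
  have hinj : Function.Injective Q := by
    rw [← LinearMap.ker_eq_bot, LinearMap.ker_eq_bot']
    intro v hv
    by_contra h0
    exact hn v h0 hv
  let e := LinearEquiv.ofInjectiveEndo Q hinj
  have h1 : e.conj P = P + LinearMap.id := by
    ext v
    obtain ⟨w, rfl⟩ := e.surjective v
    have := h w
    rw [sub_eq_iff_eq_add'] at this
    change e (P (e.symm (e w))) = P (e w) + e w
    rw [LinearEquiv.symm_apply_apply]
    exact this
  have h2 := LinearMap.trace_conj' P e
  rw [h1, map_add, LinearMap.trace_id] at h2
  have : (Module.finrank ℝ V : ℝ) = 0 := by linarith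
  exact (Module.finrank_pos (R := ℝ) (M := V)).ne' (by exact_mod_cast this)

theorem exists_kernel_vector {C : Coeff} {μ : ℝ} {S : Submodule ℝ (Fin 3 → ℝ)} (hS : S ≠ ⊥)
    (hinv : ∀ i, ∀ w ∈ S, jetOp C μ i w ∈ S)
    (hcomm : ∀ w ∈ S,
      jetOp C μ 1 (jetOp C μ 0 w) - jetOp C μ 0 (jetOp C μ 1 w) = jetOp C μ 1 w) :
    ∃ w ∈ S, w ≠ 0 ∧ jetOp C μ 1 w = 0 ∧ jetOp C μ 1 (jetOp C μ 0 w) = 0 := by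
  have : Nontrivial S := Submodule.nontrivial_iff_ne_bot.2 hS
  obtain ⟨w, hw, hQ⟩ := exists_ne_zero_of_comm_eq ((jetOp C μ 0).restrict (hinv 0))
    ((jetOp C μ 1).restrict (hinv 1)) fun v => Subtype.ext (by simpa using hcomm v.1 v.2)
  have hQ' : jetOp C μ 1 w.1 = 0 := by simpa using congrArg Subtype.val hQ
  refine ⟨w.1, w.2, by simpa using hw, hQ', ?_⟩
  have := hcomm w.1 w.2
  rwa [hQ', map_zero, sub_zero] at this

/-- The equations saying that `(x¹)^s` solves the quasi-Einstein equation. -/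
structure PowEq (C : Coeff) (μ s : ℝ) : Prop where
  h00 : s * (s - 1) - C.c 0 0 0 * s = μ * C.symRic 0 0
  h01 : -(C.c 0 1 0 * s) = μ * C.symRic 0 1
  h11 : -(C.c 1 1 0 * s) = μ * C.symRic 1 1

/-- A nontrivial solution forces a solution that is a power of `x¹`. If `C₁₂¹ = C₂₂¹ = 0`, then the
kernel of `x¹ ∂₂` on jets can be two-dimensional, but then `C₂₂² = 0`. -/
theorem exists_powEq {C : Coeff} {μ : ℝ} (hμ0 : μ ≠ 0)
    (hA : ¬ (C.c 0 1 0 = 0 ∧ C.c 1 1 0 = 0 ∧ C.c 1 1 1 = 0))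
    {S : Submodule ℝ (Fin 3 → ℝ)} (hS : S ≠ ⊥) (hinv : ∀ i, ∀ w ∈ S, jetOp C μ i w ∈ S)
    (hcomm : ∀ w ∈ S,
      jetOp C μ 1 (jetOp C μ 0 w) - jetOp C μ 0 (jetOp C μ 1 w) = jetOp C μ 1 w) :
    ∃ s, PowEq C μ s ∧ ![1, s, 0] ∈ S := by
  obtain ⟨w, hwS, hw, hQ, hQP⟩ := exists_kernel_vector hS hinv hcomm
  obtain ⟨p, q, r, rfl⟩ : ∃ p q r, w = ![p, q, r] :=
    ⟨w 0, w 1, w 2, by ext k; fin_cases k <;> rfl⟩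
  rw [jetOp_one] at hQ
  have hr : r = 0 := by simpa using congrFun hQ 0
  subst hr
  have h1 : μ * C.symRic 0 1 * p + C.c 0 1 0 * q = 0 := by simpa using congrFun hQ 1
  have h2 : μ * C.symRic 1 1 * p + C.c 1 1 0 * q = 0 := by simpa using congrFun hQ 2
  rw [jetOp_zero, jetOp_one] at hQP
  have h3 := congrFun hQP 1
  have h4 := congrFun hQP 2
  simp only [mul_zero, add_zero, h1, Matrix.cons_val, Pi.zero_apply] at h3 h4
  set t := μ * C.symRic 0 0 * p + (1 + C.c 0 0 0) * q with ht
  by_cases hp : p * t - q * q = 0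
  · -- the vector is an eigenvector of `jetOp C μ 0`
    have hp0 : p ≠ 0 := by
      rintro rfl
      have : q = 0 := by simpa using hp
      subst this
      exact hw (by ext k; fin_cases k <;> rfl)
    refine ⟨q / p, ⟨?_, ?_, ?_⟩, ?_⟩
    · field_simp
      linear_combination -hp + p * ht
    · field_simp
      linear_combination -h1
    · field_simp
      linear_combination -h2
    · have := S.smul_mem p⁻¹ hwS
      convert this using 1
      ext k
      fin_cases k
      · simp [hp0]
      · simp [div_eq_inv_mul]
      · simp
  · exfalso
    have solve : ∀ a b : ℝ, a * p + b * q = 0 → a * q + b * t = 0 → a = 0 ∧ b = 0 := by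
      intro a b e1 e2
      constructor
      · refine (mul_eq_zero.1 ?_).resolve_right hp
        linear_combination t * e1 - q * e2
      · refine (mul_eq_zero.1 ?_).resolve_right hp
        linear_combination p * e2 - q * e1
    obtain ⟨a1, a2⟩ := solve _ _ h1 h3
    obtain ⟨-, b2⟩ := solve _ _ h2 h4
    have h := (mul_eq_zero.1 a1).resolve_left hμ0
    rw [Coeff.symRic_zero_one, a2, b2] at h
    exact hA ⟨a2, b2, by linear_combination 2 * h⟩

theorem PowEq.ne_zero {C : Coeff} {μ s : ℝ} (hμ0 : μ ≠ 0) (h : PowEq C μ s)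
    (hρ : ∃ i j, C.symRic i j ≠ 0) : s ≠ 0 := by
  rintro rfl
  obtain ⟨h00, h01, h11⟩ := h
  simp [hμ0] at h00 h01 h11
  obtain ⟨i, j, hij⟩ := hρ
  refine hij ?_
  fin_cases i <;> fin_cases j <;> simp [h00, h01, h11, C.symRic_comm 1 0]

/-- If `C₂₂¹ = 0`, then a power of `x¹` is a solution only for `μ = -1` or if the surface is also of
Type `A`. -/
theorem PowEq.c110_ne_zero {C : Coeff} {μ s : ℝ} (hμ0 : μ ≠ 0) (hμ1 : μ ≠ -1) (hs : s ≠ 0)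
    (hA : ¬ (C.c 0 1 0 = 0 ∧ C.c 1 1 0 = 0 ∧ C.c 1 1 1 = 0)) (h : PowEq C μ s) :
    C.c 1 1 0 ≠ 0 := by
  intro h110
  obtain ⟨h00, h01, h11⟩ := h
  rw [Coeff.symRic_one_one, h110] at h11
  rw [Coeff.symRic_zero_one, h110] at h01
  rw [Coeff.symRic_zero_zero] at h00
  have e : C.c 0 1 0 * (C.c 1 1 1 - C.c 0 1 0) = 0 := by
    refine mul_left_cancel₀ hμ0 ?_
    linear_combination -h11
  rcases mul_eq_zero.1 e with e | e
  · rw [e] at h01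
    have : C.c 1 1 1 = 0 := by
      refine mul_left_cancel₀ hμ0 ?_
      linear_combination -2 * h01
    exact hA ⟨e, h110, this⟩
  · by_cases h0 : C.c 0 1 0 = 0
    · exact hA ⟨h0, h110, by linear_combination e + h0⟩
    · have e1 : -s = μ * C.c 0 1 1 := by
        refine mul_left_cancel₀ h0 ?_
        linear_combination h01 + μ / 2 * e
      have e2 : s = C.c 0 1 1 := by
        refine mul_left_cancel₀ hs ?_
        linear_combination h00 + μ * C.c 0 0 1 * e - (C.c 0 0 0 - C.c 0 1 1 + 1) * e1
      rw [← e2] at e1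
      exact hμ1 (mul_right_cancel₀ hs (by linear_combination -e1))

/-- For normalized constants, the equations for a power solution determine the exponent, and become
the equations of the theorem. -/
theorem powEq_normalized_iff {D : Coeff} {ε μ : ℝ} (hε : ε * ε = 1) (h010 : D.c 0 1 0 = 0)
    (h110 : D.c 1 1 0 = ε) (hμ0 : μ ≠ 0) {s : ℝ} (hs : s ≠ 0) :
    PowEq D μ s ↔ D.c 1 1 1 = ε * 2 * D.c 0 0 1 ∧ s = -(μ * (D.c 0 0 0 - D.c 0 1 1 - 1)) ∧
      μ = (-(D.c 0 0 0) ^ 2 + 2 * D.c 0 0 0 * D.c 0 1 1 + ε * 2 * (D.c 0 0 1) ^ 2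
              - (D.c 0 1 1) ^ 2 + 2 * D.c 0 1 1 + 1) / (D.c 0 0 0 - D.c 0 1 1 - 1) ^ 2 ∧
      D.c 0 0 0 - D.c 0 1 1 - 1 ≠ 0 := by
  constructor
  · rintro ⟨h00, h01, h11⟩
    rw [Coeff.symRic_one_one, h110, h010] at h11
    rw [Coeff.symRic_zero_one, h110, h010] at h01
    rw [Coeff.symRic_zero_zero, h010] at h00
    have e1 : D.c 1 1 1 = ε * 2 * D.c 0 0 1 := by
      refine mul_left_cancel₀ hμ0 ?_
      linear_combination -2 * h01
    have e2 : s = -(μ * (D.c 0 0 0 - D.c 0 1 1 - 1)) := by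
      linear_combination -ε * h11 - (s + μ * (D.c 0 0 0 - D.c 0 1 1 - 1)) * hε
    have e3 : D.c 0 0 0 - D.c 0 1 1 - 1 ≠ 0 := by
      intro h
      rw [h] at e2
      exact hs (by simpa using e2)
    refine ⟨e1, e2, ?_, e3⟩
    rw [eq_div_iff (pow_ne_zero 2 e3)]
    refine mul_left_cancel₀ hμ0 ?_
    rw [e1, e2] at h00
    linear_combination h00
  · rintro ⟨e1, e2, e3, e4⟩
    rw [eq_div_iff (pow_ne_zero 2 e4)] at e3
    constructor
    · rw [Coeff.symRic_zero_zero, h010, e1, e2]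
      linear_combination μ * e3
    · rw [Coeff.symRic_zero_one, h010, h110, e1]
      ring
    · rw [Coeff.symRic_one_one, h010, h110, e2]
      ring

/-- A jet space containing `(0, 1, 0)` is everything; this is the case of dimension three, which
only occurs for `μ = -1`. -/
theorem notMem_jetSpace {D : Coeff} {ε μ s : ℝ} (hε : ε * ε = 1) (h010 : D.c 0 1 0 = 0)
    (h110 : D.c 1 1 0 = ε) (hμ0 : μ ≠ 0) (hμ1 : μ ≠ -1) (hs : s ≠ 0) (h : PowEq D μ s)
    {S : Submodule ℝ (Fin 3 → ℝ)} (hinv : ∀ i, ∀ w ∈ S, jetOp D μ i w ∈ S)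
    (hcomm : ∀ w ∈ S,
      jetOp D μ 1 (jetOp D μ 0 w) - jetOp D μ 0 (jetOp D μ 1 w) = jetOp D μ 1 w) :
    ![0, 1, 0] ∉ S := by
  intro hS
  obtain ⟨e1, e2, -, -⟩ := (powEq_normalized_iff hε h010 h110 hμ0 hs).1 h
  have hε0 : ε ≠ 0 := left_ne_zero_of_mul (hε ▸ one_ne_zero)
  have r01 : μ * D.symRic 0 1 = 0 := by rw [← h.h01, h010]; ring
  have r11 : μ * D.symRic 1 1 = -(ε * s) := by rw [← h.h11, h110]
  have r00 := h.h00
  have hS' : ![0, 0, 1] ∈ S := by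
    have h1 := S.smul_mem ε (hinv 1 _ hS)
    rw [jetOp_one, h010, h110] at h1
    simpa [hε] using h1
  have k1 := hcomm _ hS
  have k2 := hcomm _ hS'
  simp only [jetOp_zero, jetOp_one, h010, h110, r01, r11, ← r00] at k1 k2
  have a1 := congrFun k1 1
  have a2 := congrFun k1 2
  have b1 := congrFun k2 1
  simp at a1 a2 b1
  have hb : D.c 0 0 1 = 0 := by
    rcases a1 with h | h
    · exact h
    · exact absurd h hε0
  have ha : D.c 0 0 0 = s + D.c 0 1 1 + 1 := by
    refine mul_left_cancel₀ hε0 ?_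
    linear_combination a2
  have hc : s = D.c 0 1 1 := by
    rw [hb, ha] at b1
    linear_combination b1 / 2
  rw [ha, ← hc] at e2
  exact hμ1 (mul_right_cancel₀ hs (by linear_combination e2))

/-- The equations for a two-dimensional solution space: they say that besides `(x¹)^s` the function
`(x¹)^s (x² - 2 C₁₁² x¹)` is a solution. -/
theorem exponent_eq_of_two_le_finrank {D : Coeff} {ε μ s : ℝ} (hε : ε * ε = 1)
    (h010 : D.c 0 1 0 = 0) (h110 : D.c 1 1 0 = ε) (hμ0 : μ ≠ 0) (hμ1 : μ ≠ -1) (hs : s ≠ 0)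
    (h : PowEq D μ s)
    {S : Submodule ℝ (Fin 3 → ℝ)} (hinv : ∀ i, ∀ w ∈ S, jetOp D μ i w ∈ S)
    (hcomm : ∀ w ∈ S,
      jetOp D μ 1 (jetOp D μ 0 w) - jetOp D μ 0 (jetOp D μ 1 w) = jetOp D μ 1 w)
    (hsS : ![1, s, 0] ∈ S) (h2 : 2 ≤ Module.finrank ℝ S) :
    s = D.c 0 1 1 ∧ D.c 0 0 1 * (1 - 2 * (D.c 0 0 0 - 2 * D.c 0 1 1)) = 0 := by
  have hn := notMem_jetSpace hε h010 h110 hμ0 hμ1 hs h hinv hcomm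
  have hz : ∀ w ∈ S, w 0 = 0 → w 2 = 0 → w 1 = 0 := by
    intro w hw h0 h2
    by_contra h1
    refine hn ?_
    convert S.smul_mem (w 1)⁻¹ hw using 1
    ext k
    fin_cases k <;> simp [h0, h1, h2]
  obtain ⟨u, hu⟩ : ∃ u, ![0, u, 1] ∈ S := by
    by_contra! hno
    have hle : S ≤ Submodule.span ℝ {![1, s, 0]} := by
      intro w hw
      obtain ⟨p, q, r, rfl⟩ : ∃ p q r, w = ![p, q, r] :=
        ⟨w 0, w 1, w 2, by ext k; fin_cases k <;> rfl⟩
      have hw1 := S.sub_mem hw (S.smul_mem p hsS)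
      have hr : r = 0 := by
        by_contra hr
        have := S.smul_mem r⁻¹ hw1
        refine hno (r⁻¹ * (q - p * s)) ?_
        simpa [hr] using this
      have hq : q - p * s = 0 := by simpa using hz _ hw1 (by simp) (by simp [hr])
      refine Submodule.mem_span_singleton.2 ⟨p, ?_⟩
      rw [hr, sub_eq_zero.1 hq]
      simp
    have h3 := (Submodule.finrank_mono hle).trans (finrank_span_le_card _)
    simp at h3
    omega
  obtain ⟨e1, -, -, -⟩ := (powEq_normalized_iff hε h010 h110 hμ0 hs).1 h
  have hε0 : ε ≠ 0 := left_ne_zero_of_mul (hε ▸ one_ne_zero)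
  have r01 : μ * D.symRic 0 1 = 0 := by rw [← h.h01, h010]; ring
  have r11 : μ * D.symRic 1 1 = -(ε * s) := by rw [← h.h11, h110]
  have r00 := h.h00
  have hP := hinv 0 _ hu
  have hQ := hinv 1 _ hu
  have hc := hcomm _ hu
  simp only [jetOp_zero, jetOp_one, h010, h110, r01, r11, ← r00, e1] at hP hQ hc
  have c2 := congrFun hc 2
  simp at c2
  have hQ' := hz _ (S.sub_mem (S.sub_mem hQ hsS) (S.smul_mem (ε * u + ε * 2 * D.c 0 0 1) hu))
    (by simp) (by simp)
  have hP' := hz _ (S.sub_mem (S.sub_mem hP (S.smul_mem u hsS)) (S.smul_mem (1 + D.c 0 1 1) hu))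
    (by simp) (by simp)
  simp at hQ' hP'
  -- The commutator relation says that `jetOp D μ 1` is nilpotent on `S`, so that its eigenvalue
  -- `ε u + 2 ε C₁₁²` modulo `(1, s, 0)` vanishes.
  have hq : u = -2 * D.c 0 0 1 := by
    refine mul_left_cancel₀ hε0 ?_
    linear_combination ε * hP' - c2
  have hs' : s = D.c 0 1 1 := by
    rw [hq] at hQ'
    linear_combination -hQ'
  refine ⟨hs', ?_⟩
  rw [hq, hs'] at hP'
  linear_combination hP'

/-! ### Dimensions of the solution spaces -/

theorem exists_symRic_ne_zero {C : Coeff}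
    (hρ : ∃ x ∈ halfPlane, ∃ i j, symRicci (typeB C) x i j ≠ 0) : ∃ i j, C.symRic i j ≠ 0 := by
  obtain ⟨x, hx, i, j, h⟩ := hρ
  rw [symRicci_typeB C hx] at h
  exact ⟨i, j, right_ne_zero_of_mul h⟩

/-- Linear equivalence preserves the nonvanishing of the symmetric Ricci tensor. -/
theorem LinearlyEquivalent.symRic_ne_zero {C D : Coeff} (h : LinearlyEquivalent C D)
    (hρ : ∃ i j, C.symRic i j ≠ 0) : ∃ i j, D.symRic i j ≠ 0 := by
  obtain ⟨a, b, hb, h⟩ := linearlyEquivalent_iff.1 h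
  obtain ⟨h00, h01, h11⟩ := h.symRic hb
  by_contra! hD
  obtain ⟨i, j, hij⟩ := hρ
  refine hij ?_
  simp only [hD] at h00 h01 h11
  fin_cases i <;> fin_cases j <;> simp [h00, h01, h11, C.symRic_comm 1 0]

theorem PowEq.one_le_rank {C : Coeff} {μ s : ℝ} (h : PowEq C μ s) :
    1 ≤ Module.rank ℝ (eigenspace μ (typeB C)) := by
  have hm : powSol s 1 0 0 ∈ eigenspace μ (typeB C) :=
    powSol_mem h.h00 h.h01 h.h11 (by ring) (by ring) (by ring)
  have hne : (⟨_, hm⟩ : eigenspace μ (typeB C)) ≠ 0 := by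
    intro h0
    have := congrFun (congrArg Subtype.val h0) ![1, 0]
    simp [powSol] at this
  exact Cardinal.one_le_iff_ne_zero.2 ((rank_pos_iff_exists_ne_zero).2 ⟨_, hne⟩).ne'

theorem one_le_rank_iff {D : Coeff} {μ : ℝ} (hμ0 : μ ≠ 0)
    (hA : ¬ (D.c 0 1 0 = 0 ∧ D.c 1 1 0 = 0 ∧ D.c 1 1 1 = 0)) :
    1 ≤ Module.rank ℝ (eigenspace μ (typeB D)) ↔ ∃ s, PowEq D μ s := by
  refine ⟨fun h => ?_, fun ⟨s, hs⟩ => hs.one_le_rank⟩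
  obtain ⟨S, hrank, hinv, hcomm⟩ := exists_jetSpace D μ
  have hS : S ≠ ⊥ := by
    rintro rfl
    have := h.trans hrank
    simp at this
  obtain ⟨s, hs, -⟩ := exists_powEq hμ0 hA hS hinv hcomm
  exact ⟨s, hs⟩

/-- The dimension is at most two because the jet space is proper, and at least two because of the
solutions `(x¹)^s` and `(x¹)^s (x² - 2 C₁₁² x¹)`. -/
theorem rank_eq_two_iff {D : Coeff} {ε μ s : ℝ} (hε : ε * ε = 1) (h010 : D.c 0 1 0 = 0)
    (h110 : D.c 1 1 0 = ε) (hμ0 : μ ≠ 0) (hμ1 : μ ≠ -1) (hs : s ≠ 0) (h : PowEq D μ s) :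
    Module.rank ℝ (eigenspace μ (typeB D)) = 2 ↔
      s = D.c 0 1 1 ∧ D.c 0 0 1 * (1 - 2 * (D.c 0 0 0 - 2 * D.c 0 1 1)) = 0 := by
  have hε0 : ε ≠ 0 := left_ne_zero_of_mul (hε ▸ one_ne_zero)
  obtain ⟨e1, e2, -, -⟩ := (powEq_normalized_iff hε h010 h110 hμ0 hs).1 h
  obtain ⟨S, hrank, hinv, hcomm⟩ := exists_jetSpace D μ
  have hn := notMem_jetSpace hε h010 h110 hμ0 hμ1 hs h hinv hcomm
  constructor
  · intro hr
    rw [hr] at hrank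
    have h2 : 2 ≤ Module.finrank ℝ S := by exact_mod_cast hrank
    have hS : S ≠ ⊥ := by
      rintro rfl
      simp at h2
    obtain ⟨t, ht, htS⟩ := exists_powEq hμ0 (fun h => hε0 (h110 ▸ h.2.1)) hS hinv hcomm
    have hts : t = s := mul_left_cancel₀ hε0 (by
      rw [← h110]; linear_combination -ht.h11 + h.h11)
    subst hts
    exact exponent_eq_of_two_le_finrank hε h010 h110 hμ0 hμ1 hs h hinv hcomm htS h2
  · rintro ⟨hs', hb⟩
    apply le_antisymm
    · refine hrank.trans ?_
      have : Module.finrank ℝ S < 3 := by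
        have := Submodule.finrank_lt (s := S) (fun h => hn (h ▸ Submodule.mem_top))
        simpa using this
      exact_mod_cast Nat.lt_succ_iff.1 this
    · have r01 : μ * D.symRic 0 1 = 0 := by rw [← h.h01, h010]; ring
      have hm1 : powSol s 1 0 0 ∈ eigenspace μ (typeB D) :=
        powSol_mem h.h00 h.h01 h.h11 (by ring) (by ring) (by ring)
      have hm2 : powSol s 0 (-2 * D.c 0 0 1) 1 ∈ eigenspace μ (typeB D) := by
        refine powSol_mem h.h00 h.h01 h.h11 ?_ ?_ ?_
        · rw [← h.h00, hs']
          linear_combination -hb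
        · rw [r01, h010, hs']
          ring
        · rw [← h.h11, h110, e1]
          ring
      have hli : LinearIndependent ℝ ![(⟨_, hm1⟩ : eigenspace μ (typeB D)), ⟨_, hm2⟩] := by
        rw [LinearIndependent.pair_iff]
        intro p q hpq
        have hpq := congrArg Subtype.val hpq
        have h0 := congrFun hpq ![1, 2 * D.c 0 0 1]
        have h1 := congrFun hpq ![1, 2 * D.c 0 0 1 + 1]
        simp [powSol] at h0 h1
        exact ⟨h0, by simpa [h0] using h1⟩
      simpa using hli.cardinal_le_rank

/-- The parameters of the normalized surfaces with a two-dimensional solution space. The excluded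
factor `C₁₁¹ = 2 C₁₂² + 1` belongs to `μ = -1`. -/
theorem two_dim_parameters {D : Coeff} {ε μ : ℝ} (hε : ε * ε = 1) (h010 : D.c 0 1 0 = 0)
    (h110 : D.c 1 1 0 = ε) (hμ0 : μ ≠ 0) (hμ1 : μ ≠ -1) :
    (∃ s, s ≠ 0 ∧ PowEq D μ s ∧
      s = D.c 0 1 1 ∧ D.c 0 0 1 * (1 - 2 * (D.c 0 0 0 - 2 * D.c 0 1 1)) = 0) ↔
    ((D.c 0 0 0 = -1 + D.c 0 1 1 ∧ D.c 0 0 1 = 0 ∧ D.c 0 1 0 = 0 ∧ D.c 1 1 0 = ε ∧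
        D.c 1 1 1 = 0 ∧ μ = 1 / 2 * D.c 0 1 1 ∧ D.c 0 1 1 ≠ 0) ∨
      (D.c 0 0 0 = -(1 / 2) * (5 + ε * 16 * (D.c 0 0 1) ^ 2) ∧ D.c 0 1 0 = 0 ∧
        D.c 0 1 1 = -(1 / 2) * (3 + ε * 8 * (D.c 0 0 1) ^ 2) ∧
        D.c 1 1 0 = ε ∧ D.c 1 1 1 = ε * 2 * D.c 0 0 1 ∧
        μ = -((3 + ε * 8 * (D.c 0 0 1) ^ 2) / (4 + ε * 8 * (D.c 0 0 1) ^ 2)) ∧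
        D.c 0 0 1 ≠ 0 ∧ 4 + ε * 8 * (D.c 0 0 1) ^ 2 ≠ 0)) := by
  constructor
  · rintro ⟨s, hs, h, hs', hb⟩
    obtain ⟨e1, e2, -, e4⟩ := (powEq_normalized_iff hε h010 h110 hμ0 hs).1 h
    have h00 := h.h00
    rw [Coeff.symRic_zero_zero, h010, e1] at h00
    by_cases b0 : D.c 0 0 1 = 0
    · left
      rw [b0, hs'] at h00
      rw [hs'] at e2 hs
      have hm : μ = D.c 0 1 1 - (1 + D.c 0 0 0) / 2 := by
        refine mul_left_cancel₀ hs ?_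
        linear_combination -h00 / 2 - D.c 0 1 1 * e2 / 2
      rw [hm] at e2
      have hf : (D.c 0 0 0 - D.c 0 1 1 + 1) * (D.c 0 0 0 - 2 * D.c 0 1 1 - 1) = 0 := by
        linear_combination -2 * e2
      have ha : D.c 0 0 0 - D.c 0 1 1 + 1 = 0 := by
        refine (mul_eq_zero.1 hf).resolve_right fun h => hμ1 ?_
        linear_combination hm - h / 2
      refine ⟨by linear_combination ha, b0, h010, h110, by rw [e1, b0, mul_zero], ?_, hs⟩
      linear_combination hm - ha / 2
    · right
      have ha : D.c 0 0 0 = 2 * D.c 0 1 1 + 1 / 2 := by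
        have := (mul_eq_zero.1 hb).resolve_left b0
        linear_combination -this / 2
      rw [hs'] at e2 h00 hs
      rw [ha] at e2 h00 e4
      have hc : D.c 0 1 1 = -(1 / 2) * (3 + ε * 8 * (D.c 0 0 1) ^ 2) := by
        refine mul_left_cancel₀ hs ?_
        linear_combination 2 * (D.c 0 1 1 - 1 / 2) * h00
          + 2 * (D.c 0 1 1 * (D.c 0 1 1 + 3 / 2) + 2 * ε * (D.c 0 0 1) ^ 2) * e2
      have h4 : 4 + ε * 8 * (D.c 0 0 1) ^ 2 ≠ 0 := by
        intro h
        exact e4 (by linear_combination hc - h / 2)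
      refine ⟨by rw [ha, hc]; ring, h010, hc, h110, e1, ?_, b0, h4⟩
      rw [← neg_div, eq_div_iff h4]
      linear_combination 2 * hc - 2 * e2 + 2 * μ * hc
  · rintro (⟨ha, hb, -, -, h111, hμ, hc⟩ | ⟨ha, -, hc, -, h111, hμ, hb, h4⟩)
    · refine ⟨D.c 0 1 1, hc, ⟨?_, ?_, ?_⟩, rfl, by rw [hb, zero_mul]⟩
      · rw [Coeff.symRic_zero_zero, hb, ha, hμ]; ring
      · rw [Coeff.symRic_zero_one, hb, h111, h010]; ring
      · rw [Coeff.symRic_one_one, h010, h110, ha, hμ]; ring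
    · rw [← neg_div, eq_div_iff h4] at hμ
      have hc0 : D.c 0 1 1 ≠ 0 := by
        intro h0
        rw [h0] at hc
        have h : 3 + ε * 8 * (D.c 0 0 1) ^ 2 = 0 := by linear_combination 2 * hc
        rw [h, neg_zero] at hμ
        exact (mul_ne_zero hμ0 h4) hμ
      refine ⟨D.c 0 1 1, hc0, ⟨?_, ?_, ?_⟩, rfl, ?_⟩
      · rw [Coeff.symRic_zero_zero, h010, h111, ha, hc]
        linear_combination -2 * ε * (D.c 0 0 1) ^ 2 * hμ
      · rw [Coeff.symRic_zero_one, h010, h110, h111]; ring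
      · rw [Coeff.symRic_one_one, h010, h110, ha, hc]
        linear_combination ε / 2 * hμ
      · rw [ha, hc]; ring

end HomogeneousSurface

end

open HomogeneousSurface in
theorem theorem1p17 (C : HomogeneousSurface.Coeff)
    (hA : ¬ HomogeneousSurface.IsTypeA (HomogeneousSurface.typeB C))
    (hρ : ∃ x ∈ HomogeneousSurface.halfPlane, ∃ i j,
      HomogeneousSurface.symRicci (HomogeneousSurface.typeB C) x i j ≠ 0)
    (μ : ℝ) (hμ0 : μ ≠ 0) (hμ1 : μ ≠ -1) :
    (1 ≤ Module.rank ℝ (HomogeneousSurface.eigenspace μ (HomogeneousSurface.typeB C)) ↔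
      ∃ (D : HomogeneousSurface.Coeff) (ε : ℝ), HomogeneousSurface.LinearlyEquivalent C D ∧
        (ε = 1 ∨ ε = -1) ∧
        D.c 0 1 0 = 0 ∧ D.c 1 1 0 = ε ∧ D.c 1 1 1 = ε * 2 * D.c 0 0 1 ∧
        μ = (-(D.c 0 0 0) ^ 2 + 2 * D.c 0 0 0 * D.c 0 1 1 + ε * 2 * (D.c 0 0 1) ^ 2
              - (D.c 0 1 1) ^ 2 + 2 * D.c 0 1 1 + 1) / (D.c 0 0 0 - D.c 0 1 1 - 1) ^ 2 ∧
        D.c 0 0 0 - D.c 0 1 1 - 1 ≠ 0) ∧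
    (Module.rank ℝ (HomogeneousSurface.eigenspace μ (HomogeneousSurface.typeB C)) = 2 ↔
      ∃ (D : HomogeneousSurface.Coeff) (ε : ℝ), HomogeneousSurface.LinearlyEquivalent C D ∧
        (ε = 1 ∨ ε = -1) ∧
        ((D.c 0 0 0 = -1 + D.c 0 1 1 ∧ D.c 0 0 1 = 0 ∧ D.c 0 1 0 = 0 ∧ D.c 1 1 0 = ε ∧
            D.c 1 1 1 = 0 ∧ μ = 1 / 2 * D.c 0 1 1 ∧ D.c 0 1 1 ≠ 0) ∨
          (D.c 0 0 0 = -(1 / 2) * (5 + ε * 16 * (D.c 0 0 1) ^ 2) ∧ D.c 0 1 0 = 0 ∧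
            D.c 0 1 1 = -(1 / 2) * (3 + ε * 8 * (D.c 0 0 1) ^ 2) ∧
            D.c 1 1 0 = ε ∧ D.c 1 1 1 = ε * 2 * D.c 0 0 1 ∧
            μ = -((3 + ε * 8 * (D.c 0 0 1) ^ 2) / (4 + ε * 8 * (D.c 0 0 1) ^ 2)) ∧
            D.c 0 0 1 ≠ 0 ∧ 4 + ε * 8 * (D.c 0 0 1) ^ 2 ≠ 0))) := by
  have hρC := exists_symRic_ne_zero hρ
  have hεε : ∀ {ε : ℝ}, ε = 1 ∨ ε = -1 → ε * ε = 1 := by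
    rintro ε (rfl | rfl) <;> norm_num
  have hnorm : 1 ≤ Module.rank ℝ (eigenspace μ (typeB C)) → ∃ (D : Coeff) (ε : ℝ),
      LinearlyEquivalent C D ∧ (ε = 1 ∨ ε = -1) ∧ D.c 0 1 0 = 0 ∧ D.c 1 1 0 = ε ∧
      ∃ s, s ≠ 0 ∧ PowEq D μ s := by
    intro h
    have hA' : ¬ (C.c 0 1 0 = 0 ∧ C.c 1 1 0 = 0 ∧ C.c 1 1 1 = 0) := fun ⟨h1, h2, h3⟩ =>
      hA (isTypeA_typeB h1 h2 h3)
    obtain ⟨s, hs⟩ := (one_le_rank_iff hμ0 hA').1 h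
    obtain ⟨D, ε, hCD, hε, h010, h110⟩ :=
      exists_normalized (hs.c110_ne_zero hμ0 hμ1 (hs.ne_zero hμ0 hρC) hA')
    have hε0 : D.c 1 1 0 ≠ 0 := by
      rw [h110]
      exact left_ne_zero_of_mul (hεε hε ▸ one_ne_zero)
    obtain ⟨t, ht⟩ := (one_le_rank_iff hμ0 fun h => hε0 h.2.1).1 (rank_eigenspace_eq hCD μ ▸ h)
    exact ⟨D, ε, hCD, hε, h010, h110, t, ht.ne_zero hμ0 (hCD.symRic_ne_zero hρC), ht⟩
  constructor
  · constructor
    · intro h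
      obtain ⟨D, ε, hCD, hε, h010, h110, s, hs, hpow⟩ := hnorm h
      obtain ⟨e1, -, e3, e4⟩ := (powEq_normalized_iff (hεε hε) h010 h110 hμ0 hs).1 hpow
      exact ⟨D, ε, hCD, hε, h010, h110, e1, e3, e4⟩
    · rintro ⟨D, ε, hCD, hε, h010, h110, e1, e3, e4⟩
      rw [rank_eigenspace_eq hCD μ]
      exact ((powEq_normalized_iff (hεε hε) h010 h110 hμ0
        (neg_ne_zero.2 (mul_ne_zero hμ0 e4))).2 ⟨e1, rfl, e3, e4⟩).one_le_rank
  · constructor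
    · intro h
      obtain ⟨D, ε, hCD, hε, h010, h110, s, hs, hpow⟩ := hnorm (by rw [h]; exact Nat.one_le_ofNat)
      rw [rank_eigenspace_eq hCD μ,
        rank_eq_two_iff (hεε hε) h010 h110 hμ0 hμ1 hs hpow] at h
      exact ⟨D, ε, hCD, hε,
        (two_dim_parameters (hεε hε) h010 h110 hμ0 hμ1).1 ⟨s, hs, hpow, h⟩⟩
    · rintro ⟨D, ε, hCD, hε, hD⟩
      have h010 : D.c 0 1 0 = 0 := by
        rcases hD with ⟨-, -, h, -⟩ | ⟨-, h, -⟩ <;> exact h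
      have h110 : D.c 1 1 0 = ε := by
        rcases hD with ⟨-, -, -, h, -⟩ | ⟨-, -, -, h, -⟩ <;> exact h
      obtain ⟨s, hs, hpow, h⟩ := (two_dim_parameters (hεε hε) h010 h110 hμ0 hμ1).2 hD
      rw [rank_eigenspace_eq hCD μ]
      exact (rank_eq_two_iff (hεε hε) h010 h110 hμ0 hμ1 hs hpow).2 h
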